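/- Let $n\ge 2$ and $\alpha>1$. A model function is a function $\psi\in C^\infty([0,+\infty))$ with $\psi>0$ on $(0,+\infty)$, $\psi(0)=0$, $\psi'(0)=1$ and $\psi^{(2k)}(0)=0$ for all $k\in\mathbb N$. The associated $n$-dimensional model manifold $\mathbb M^n$ is $\mathbb R^n$ with the metric given in polar coordinates about the origin by $\mathsf g=dr^2+\psi^2(r)\,\mathsf g_{\mathbb S^{n-1}}$; let $\Delta$ be its Laplace--Beltrami operator. Radial functions on $\mathbb M^n$ are identified with functions of $r$. Put $$2^*_\alpha:=\frac{2(\alpha(n-1)+1)}{\alpha(n-1)-1},\qquad 2^*:=\frac{2n}{n-2}\ \text{ if } n\ge 3,\qquad 2^*:=+\infty\ \text{ if } n=2 .$$ Let $D^{1,2}_{\mathrm{rad}}(\mathbb M^n)$ be the closure of the radial $C^1_c(\mathbb M^n)$ functions with respect to the norm $\left(\int_0^{+\infty}|f'|^2\psi^{n-1}\,dr\right)^{1/2}$ (under the assumptions below this is a space of functions), and for $f\in D^{1,2}_{\mathrm{rad}}(\mathbb M^n)\setminus\{0\}$ let $$R_{\psi,q}(f):=\frac{\left(\int_0^{+\infty}|f'|^2\,\psi^{n-1}\,dr\right)^{1/2}}{\left(\int_0^{+\infty}|f|^{q+1}\,\psi^{n-1}\,dr\right)^{1/(q+1)}}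 .$$ **Theorem.** Let $\psi$ be a model function such that $$\frac{\psi'(r)}{\psi(r)}\ge\frac{\sigma'(r)}{\sigma(r)}\qquad\text{for all } r>0,$$ where $\sigma$ is a model function for which there exist $\kappa_1,\kappa_2>0$ with $\kappa_1 r^\alpha\le\sigma(r)\le\kappa_2 r^\alpha$ for all $r$ large enough. Then, for every real $q$ with $2^*_\alpha-1<q<2^*-1$, there is a radial function $u\in D^{1,2}_{\mathrm{rad}}(\mathbb M^n)\setminus\{0\}$ of class $C^2$ on $\mathbb M^n$ which satisfies $$-\Delta u=u^q,\qquad u>0\qquad\text{on } \mathbb M^n,$$ and which is a Sobolev minimizer, that is, $\int_0^{+\infty}|u|^{q+1}\psi^{n-1}\,dr<+\infty$ and $$R_{\psi,q}(u)=\inf_{f\in D^{1,2}_{\mathrm{rad}}(\mathbb M^n)\setminus\{0\}}R_{\psi,q}(f).$$ -/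

import Mathlib

open Set Filter Topology MeasureTheory
open scoped ContDiff ENNReal

/-- A model function: `ψ : [0,∞) → [0,∞)`, smooth up to `0`, positive on `(0,∞)`, with `ψ(0) = 0`,
`ψ'(0) = 1` and vanishing even-order derivatives at `0`. The values of `ψ` on `(-∞,0)` are
irrelevant. -/
structure IsModelFunction (ψ : ℝ → ℝ) : Prop where
  smooth : ContDiffOn ℝ ∞ ψ (Ici 0)
  pos : ∀ r, 0 < r → 0 < ψ r
  zero : ψ 0 = 0
  deriv_zero : derivWithin ψ (Ici 0) 0 = 1
  even_deriv_zero : ∀ k : ℕ, iteratedDerivWithin (2 * k) ψ (Ici 0) 0 = 0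

/-- The metric of the `n`-dimensional model manifold with model function `ψ`, written in the
global chart `ℝⁿ` given by the exponential map at the pole `o = 0`. With `r = ‖x‖` the polar radius,
`g = dr² + ψ(r)² g_{𝕊ⁿ⁻¹}` has components
`g_ij = x_i x_j / r² + (ψ(r) / r)² (δ_ij - x_i x_j / r²)`, with `g_ij(0) = δ_ij`. -/
noncomputable def modelMetric (n : ℕ) (ψ : ℝ → ℝ) (x : EuclideanSpace ℝ (Fin n)) :
    Matrix (Fin n) (Fin n) ℝ :=
  open Classical in
  if x = 0 then 1
  else Matrix.of fun i j =>
    x i * x j / ‖x‖ ^ 2 +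
      (ψ ‖x‖ / ‖x‖) ^ 2 * ((if i = j then 1 else 0) - x i * x j / ‖x‖ ^ 2)

/-- The partial derivative `∂_i f (x)`. -/
noncomputable def partialDeriv {n : ℕ} (i : Fin n) (f : EuclideanSpace ℝ (Fin n) → ℝ)
    (x : EuclideanSpace ℝ (Fin n)) : ℝ :=
  fderiv ℝ f x (EuclideanSpace.single i 1)

/-- The Laplace–Beltrami operator of the metric with components `g` in the global chart `ℝⁿ`:
`Δ f = (1 / √det g) ∑_i ∂_i (√det g ∑_j g^{ij} ∂_j f)`. -/
noncomputable def laplaceBeltrami {n : ℕ}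
    (g : EuclideanSpace ℝ (Fin n) → Matrix (Fin n) (Fin n) ℝ)
    (f : EuclideanSpace ℝ (Fin n) → ℝ) (x : EuclideanSpace ℝ (Fin n)) : ℝ :=
  (1 / √((g x).det)) *
    ∑ i, partialDeriv i
      (fun y => √((g y).det) * ∑ j, (g y)⁻¹ i j * partialDeriv j f y) x

/-- `U` is a (classical) solution of the Lane–Emden equation `-Δ U = U ^ q`, `U > 0`, on the model
manifold with model function `ψ`. -/
structure IsLaneEmdenSolution (n : ℕ) (ψ : ℝ → ℝ) (q : ℝ)
    (U : EuclideanSpace ℝ (Fin n) → ℝ) : Prop where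
  contDiff : ContDiff ℝ 2 U
  pos : ∀ x, 0 < U x
  eqn : ∀ x, -laplaceBeltrami (modelMetric n ψ) U x = U x ^ q

/-- The radial function `x ↦ f (r(x))` on the model manifold. -/
noncomputable def radial (n : ℕ) (f : ℝ → ℝ) : EuclideanSpace ℝ (Fin n) → ℝ := fun x => f ‖x‖

/-- `x ↦ φ (r(x))` is a `C¹` function with compact support on the model manifold. -/
def IsC1cRadial (n : ℕ) (φ : ℝ → ℝ) : Prop :=
  ContDiff ℝ 1 (radial n φ) ∧ HasCompactSupport (radial n φ)

/-- `(∫₀^∞ |g|^p ψ^{n-1} dr)^{1/p}`, with values in `[0,∞]`. -/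
noncomputable def weightedNorm (n : ℕ) (ψ : ℝ → ℝ) (p : ℝ) (g : ℝ → ℝ) : ℝ≥0∞ :=
  (∫⁻ r in Ioi (0 : ℝ), ENNReal.ofReal (|g r| ^ p * ψ r ^ (n - 1))) ^ (1 / p)

/-- The space `D^{1,2}_rad`, the closure of the radial `C¹_c` functions in the norm
`(∫₀^∞ |f'|² ψ^{n-1} dr)^{1/2}`, as a space of functions of `r ∈ (0,∞)`: `f` is the limit, pointwise
and in the energy norm, of radial `C¹_c` functions. Pointwise convergence fixes the additive
constant, which the energy norm does not see.

Each element of the closure is represented by its continuous representative on `(0,∞)`. If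
`φ_k → f` pointwise and `φ_k' → deriv f` in `L²(ψ^{n-1} dr)`, then `f b - f a = ∫_a^b deriv f` for
all `0 < a < b`; so `f` is locally absolutely continuous and `deriv f` is its weak derivative. -/
def MemD12Rad (n : ℕ) (ψ : ℝ → ℝ) (f : ℝ → ℝ) : Prop :=
  ∃ φ : ℕ → ℝ → ℝ, (∀ k, IsC1cRadial n (φ k)) ∧
    (∀ r, 0 < r → Tendsto (fun k => φ k r) atTop (𝓝 (f r))) ∧
    Tendsto (fun k => weightedNorm n ψ 2 (fun r => deriv (φ k) r - deriv f r)) atTop (𝓝 0)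

/-- The set `D^{1,2}_rad ∖ {0}`. -/
def D12RadNonzero (n : ℕ) (ψ : ℝ → ℝ) : Set (ℝ → ℝ) :=
  {f | MemD12Rad n ψ f ∧ ∃ r, 0 < r ∧ f r ≠ 0}

/-- The Sobolev quotient `R_{ψ,q}(f)`. -/
noncomputable def sobolevQuotient (n : ℕ) (ψ : ℝ → ℝ) (q : ℝ) (f : ℝ → ℝ) : ℝ≥0∞ :=
  weightedNorm n ψ 2 (deriv f) / weightedNorm n ψ (q + 1) f

/-- `I_{ψ,q}`, the infimum of the Sobolev quotient over `D^{1,2}_rad ∖ {0}`. -/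
noncomputable def sobolevInf (n : ℕ) (ψ : ℝ → ℝ) (q : ℝ) : ℝ≥0∞ :=
  ⨅ f ∈ D12RadNonzero n ψ, sobolevQuotient n ψ q f

/-- `f ∈ D^{1,2}_rad ∖ {0}` has finite `L^{q+1}` norm and achieves `I_{ψ,q}`. -/
def IsSobolevMinimizer (n : ℕ) (ψ : ℝ → ℝ) (q : ℝ) (f : ℝ → ℝ) : Prop :=
  f ∈ D12RadNonzero n ψ ∧ weightedNorm n ψ (q + 1) f < ⊤ ∧
    sobolevQuotient n ψ q f = sobolevInf n ψ q

/-- The Sobolev exponent `2* = 2n/(n-2)` for `n ≥ 3`, and `2* = ∞` for `n = 2`. -/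
noncomputable def sobolevExponent (n : ℕ) : EReal :=
  if n ≤ 2 then ⊤ else ((2 * (n : ℝ) / ((n : ℝ) - 2) : ℝ) : EReal)

/-- The exponent `2*_α = 2 (α (n-1) + 1) / (α (n-1) - 1)`. -/
noncomputable def sobolevExponentAlpha (n : ℕ) (α : ℝ) : ℝ :=
  2 * (α * ((n : ℝ) - 1) + 1) / (α * ((n : ℝ) - 1) - 1)

/-! A function `f` in the energy space is determined by its derivative `h` in the Hilbert space
L²(ψ^(n-1) dr): `f r = -∫_r^∞ h`, so evaluation at `r` is, up to sign, the inner product with θ_r =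
1_(r,∞) ψ^(1-n). Since ‖θ_r‖² = G(r) = ∫_r^∞ ψ^(1-n), every `f` satisfies |f(r)| ≤ G(r)^(1/2) ‖f'‖.

Put p = q + 1. The envelope G^(1/2) lies in L^p(ψ^(n-1) dr): near the origin because p < 2*, at
infinity because p > 2*_α (`integrableOn_radialGreen_rpow_mul`). It dominates the pairings of the
whole unit ball, so by dominated convergence h ↦ ∫ |⟨θ_r, h⟩|^p is weakly sequentially continuous
there and attains its maximum `m` (`exists_forall_pairingFunctional_le`). Replacing the maximizer by
its absolute value `g` loses nothing, and f(r) = ∫_r^∞ g is then nonnegative and nonincreasing.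

Because ⟨θ_r, θ_s⟩ = G(max r s), the Euler-Lagrange equation tested on θ_r is the Green
representation m f(r) = ∫ f(s)^q G(max s r) ψ(s)^(n-1) ds. Differentiating it yields the radial
equation with zero flux at the pole (`hasDerivAt_of_green`), and the multiple u = c f with c^(q-1) =
1/m removes the constant.

What remains is regularity at the pole. The envelope gives u ≤ C r^(-β) with β slightly above
(n-2)/2, and subcriticality lets a finite bootstrap lower the exponent until `u` is bounded
(`bounded_near_zero`). Being monotone, `u` has a limit at 0, and the asymptotics of its flux make it
C² across the pole (`isLaneEmdenSolution`). Truncating u' shows that `u` belongs to the energy space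
(`memD12Rad_of_eq_integral`), and its quotient m^(-1/p) is the lower bound for all competitors
(`inv_le_sobolevQuotient`). -/

/-! ### Maximizing an L^p functional on a Hilbert ball -/

section Variational

open scoped RealInnerProductSpace

/-- The functional `h ↦ ∫ |⟪θ x, h⟫| ^ p dμ`. -/
noncomputable def pairingFunctional {Ω H : Type*} [MeasurableSpace Ω] (μ : Measure Ω)
    [NormedAddCommGroup H] [InnerProductSpace ℝ H] (θ : Ω → H) (p : ℝ) (h : H) : ℝ :=
  ∫ x, |⟪θ x, h⟫| ^ p ∂μ

variable {Ω H : Type*} [MeasurableSpace Ω] {μ : Measure Ω}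
  [NormedAddCommGroup H] [InnerProductSpace ℝ H] {θ : Ω → H} {B : Ω → ℝ} {p : ℝ}

theorem abs_inner_rpow_le (hp : 0 ≤ p) {v h : H} {b c : ℝ} (hv : ‖v‖ ≤ b) (hh : ‖h‖ ≤ c) :
    |⟪v, h⟫| ^ p ≤ b ^ p * c ^ p := by
  have hb : 0 ≤ b := (norm_nonneg _).trans hv
  rw [← Real.mul_rpow hb ((norm_nonneg _).trans hh)]
  refine Real.rpow_le_rpow (abs_nonneg _) ((abs_real_inner_le_norm _ _).trans ?_) hp
  exact mul_le_mul hv hh (norm_nonneg _) hb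

theorem aestronglyMeasurable_abs_inner_rpow
    (hmeas : ∀ h : H, AEStronglyMeasurable (fun x => ⟪θ x, h⟫) μ) (h : H) :
    AEStronglyMeasurable (fun x => |⟪θ x, h⟫| ^ p) μ :=
  ((hmeas h).aemeasurable.abs.pow_const p).aestronglyMeasurable

theorem integrable_abs_inner_rpow (hp : 0 ≤ p)
    (hmeas : ∀ h : H, AEStronglyMeasurable (fun x => ⟪θ x, h⟫) μ)
    (hB : ∀ᵐ x ∂μ, ‖θ x‖ ≤ B x) (hBp : Integrable (fun x => B x ^ p) μ) (h : H) :
    Integrable (fun x => |⟪θ x, h⟫| ^ p) μ := by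
  refine (hBp.mul_const (‖h‖ ^ p)).mono' (aestronglyMeasurable_abs_inner_rpow hmeas h) ?_
  filter_upwards [hB] with x hx
  rw [Real.norm_of_nonneg (by positivity)]
  exact abs_inner_rpow_le hp hx le_rfl

theorem pairingFunctional_nonneg (h : H) : 0 ≤ pairingFunctional μ θ p h :=
  integral_nonneg fun _ => by positivity

theorem pairingFunctional_smul (c : ℝ) (h : H) :
    pairingFunctional μ θ p (c • h) = |c| ^ p * pairingFunctional μ θ p h := by
  unfold pairingFunctional
  rw [← integral_const_mul]
  congr 1
  ext x
  rw [inner_smul_right, abs_mul, Real.mul_rpow (abs_nonneg _) (abs_nonneg _)]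

/-- Sequential Banach-Alaoglu, with `H` identified with its dual, extracts a weak limit from a
maximizing sequence. Weak convergence makes the pairings with each `θ x` converge, and `B ^ p`
dominates, so the functional passes to the limit. Homogeneity of degree `p` extends the bound from
the ball to all of `H`. -/
theorem exists_forall_pairingFunctional_le [CompleteSpace H] [TopologicalSpace.SeparableSpace H]
    (hp : 0 < p) (hmeas : ∀ h : H, AEStronglyMeasurable (fun x => ⟪θ x, h⟫) μ)
    (hB : ∀ᵐ x ∂μ, ‖θ x‖ ≤ B x) (hBp : Integrable (fun x => B x ^ p) μ) :
    ∃ g : H, ‖g‖ ≤ 1 ∧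
      ∀ h : H, pairingFunctional μ θ p h ≤ pairingFunctional μ θ p g * ‖h‖ ^ p := by
  set J := pairingFunctional μ θ p with hJ
  have hbdd : BddAbove (J '' Metric.closedBall 0 1) := by
    refine ⟨∫ x, B x ^ p ∂μ, ?_⟩
    rintro _ ⟨h, hh, rfl⟩
    refine integral_mono_ae (integrable_abs_inner_rpow hp.le hmeas hB hBp h) hBp ?_
    filter_upwards [hB] with x hx
    simpa using abs_inner_rpow_le hp.le hx (mem_closedBall_zero_iff.1 hh)
  have hne : (J '' Metric.closedBall 0 1).Nonempty := ⟨_, 0, by simp, rfl⟩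
  obtain ⟨s, -, hs, hsmem⟩ := exists_seq_tendsto_sSup hne hbdd
  choose h hh hJh using hsmem
  have hball : ∀ k, StrongDual.toWeakDual (InnerProductSpace.toDual ℝ H (h k)) ∈
      WeakDual.toStrongDual ⁻¹' Metric.closedBall (0 : StrongDual ℝ H) 1 := by
    intro k
    simpa using hh k
  obtain ⟨L, hL, φ, hφ, hlim⟩ := WeakDual.isSeqCompact_closedBall ℝ H 0 1 hball
  set g := (InnerProductSpace.toDual ℝ H).symm (WeakDual.toStrongDual L) with hg
  have hgn : ‖g‖ ≤ 1 := by
    rw [hg, LinearIsometryEquiv.norm_map]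
    simpa using hL
  have hpt : ∀ v : H, Tendsto (fun k => ⟪v, h (φ k)⟫) atTop (𝓝 ⟪v, g⟫) := by
    intro v
    have h1 := ((WeakDual.eval_continuous (𝕜 := ℝ) v).tendsto L).comp hlim
    have h2 : ⟪v, g⟫ = L v := by
      rw [real_inner_comm, hg, InnerProductSpace.toDual_symm_apply]
      rfl
    rw [h2]
    refine h1.congr fun k => ?_
    rw [real_inner_comm]
    rfl
  have hJlim : Tendsto (fun k => J (h (φ k))) atTop (𝓝 (J g)) := by
    refine tendsto_integral_of_dominated_convergence (fun x => B x ^ p)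
      (fun k => aestronglyMeasurable_abs_inner_rpow hmeas _) hBp (fun k => ?_)
      (Eventually.of_forall fun x => ?_)
    · filter_upwards [hB] with x hx
      rw [Real.norm_of_nonneg (by positivity)]
      simpa using abs_inner_rpow_le hp.le hx (mem_closedBall_zero_iff.1 (hh (φ k)))
    · exact ((hpt (θ x)).abs).rpow_const (Or.inr hp.le)
  have hJg : J g = sSup (J '' Metric.closedBall 0 1) := by
    refine tendsto_nhds_unique hJlim ?_
    exact (hs.comp hφ.tendsto_atTop).congr fun k => (hJh _).symm
  refine ⟨g, hgn, fun v => ?_⟩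
  rcases eq_or_ne v 0 with rfl | hv
  · have : J 0 = 0 := by simp [hJ, pairingFunctional, Real.zero_rpow hp.ne']
    rw [this]
    exact mul_nonneg (pairingFunctional_nonneg _) (by positivity)
  · have hv' : 0 < ‖v‖ := norm_pos_iff.2 hv
    have h1 : J (‖v‖⁻¹ • v) ≤ J g := by
      rw [hJg]
      refine le_csSup hbdd ⟨_, ?_, rfl⟩
      rw [mem_closedBall_zero_iff, norm_smul, norm_inv, norm_norm, inv_mul_cancel₀ hv'.ne']
    calc J v = J (‖v‖ • (‖v‖⁻¹ • v)) := by rw [smul_inv_smul₀ hv'.ne']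
      _ = ‖v‖ ^ p * J (‖v‖⁻¹ • v) := by rw [hJ, pairingFunctional_smul, abs_of_pos hv']
      _ ≤ J g * ‖v‖ ^ p := by
        rw [mul_comm]
        gcongr

/-- The Euler-Lagrange equation of a nonnegative maximizer of `pairingFunctional`. -/
theorem integral_inner_rpow_mul_inner_eq [CompleteSpace H] (hp : 1 < p)
    (hmeas : ∀ h : H, AEStronglyMeasurable (fun x => ⟪θ x, h⟫) μ)
    (hB : ∀ᵐ x ∂μ, ‖θ x‖ ≤ B x) (hBp : Integrable (fun x => B x ^ p) μ) {g : H} (hg : ‖g‖ ≤ 1)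
    (hmax : ∀ h : H, pairingFunctional μ θ p h ≤ pairingFunctional μ θ p g * ‖h‖ ^ p)
    (hpos : ∀ᵐ x ∂μ, 0 ≤ ⟪θ x, g⟫) (h : H) :
    Integrable (fun x => ⟪θ x, g⟫ ^ (p - 1) * ⟪θ x, h⟫) μ ∧
      ∫ x, ⟪θ x, g⟫ ^ (p - 1) * ⟪θ x, h⟫ ∂μ = pairingFunctional μ θ p g * ⟪g, h⟫ := by
  set J := pairingFunctional μ θ p with hJ
  have hp0 : 0 < p := by linarith
  have hJ0 : 0 ≤ J g := pairingFunctional_nonneg _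
  obtain ⟨p', hpp⟩ : ∃ p' : ℝ, p'.HolderConjugate p :=
    ⟨p.conjExponent, (Real.HolderConjugate.conjExponent hp).symm⟩
  have hp'1 : (p - 1) * p' = p := hpp.symm.sub_one_mul_conj
  have hcong : ∀ᵐ x ∂μ, |⟪θ x, g⟫ ^ (p - 1)| ^ p' = |⟪θ x, g⟫| ^ p := by
    filter_upwards [hpos] with x hx
    rw [abs_of_nonneg (Real.rpow_nonneg hx _), abs_of_nonneg hx, ← Real.rpow_mul hx, hp'1]
  have hintg := integrable_abs_inner_rpow hp0.le hmeas hB hBp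
  have hm1 : AEStronglyMeasurable (fun x => ⟪θ x, g⟫ ^ (p - 1)) μ :=
    ((hmeas g).aemeasurable.pow_const _).aestronglyMeasurable
  have hL1 : MemLp (fun x => ⟪θ x, g⟫ ^ (p - 1)) (ENNReal.ofReal p') μ := by
    rw [← integrable_norm_rpow_iff hm1 (by simpa using hpp.pos) ENNReal.ofReal_ne_top,
      ENNReal.toReal_ofReal hpp.nonneg]
    exact (hintg g).congr (hcong.mono fun x hx => by simpa using hx.symm)
  have hL2 : ∀ h : H, MemLp (fun x => ⟪θ x, h⟫) (ENNReal.ofReal p) μ := fun h => by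
    rw [← integrable_norm_rpow_iff (hmeas h) (by simpa using hp0) ENNReal.ofReal_ne_top,
      ENNReal.toReal_ofReal hp0.le]
    exact hintg h
  have hint : ∀ h : H, Integrable (fun x => ⟪θ x, g⟫ ^ (p - 1) * ⟪θ x, h⟫) μ := fun h => by
    have := hpp.ennrealOfReal
    exact hL1.integrable_mul (hL2 h)
  -- Hölder followed by maximality; the exponents of `J g` add up to 1.
  have hbound : ∀ h : H, ‖∫ x, ⟪θ x, g⟫ ^ (p - 1) * ⟪θ x, h⟫ ∂μ‖ ≤ J g * ‖h‖ := by
    intro h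
    have h1 := integral_mul_norm_le_Lp_mul_Lq (μ := μ) hpp hL1 (hL2 h)
    have h2 : ∫ x, ‖⟪θ x, g⟫ ^ (p - 1)‖ ^ p' ∂μ = J g := by
      refine integral_congr_ae (hcong.mono fun x hx => by simpa using hx)
    have h3 : ∫ x, ‖⟪θ x, h⟫‖ ^ p ∂μ = J h := rfl
    rw [h2, h3] at h1
    calc ‖∫ x, ⟪θ x, g⟫ ^ (p - 1) * ⟪θ x, h⟫ ∂μ‖
        ≤ ∫ x, ‖⟪θ x, g⟫ ^ (p - 1)‖ * ‖⟪θ x, h⟫‖ ∂μ := by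
          simpa only [norm_mul] using norm_integral_le_integral_norm
            (fun x => ⟪θ x, g⟫ ^ (p - 1) * ⟪θ x, h⟫)
      _ ≤ J g ^ (1 / p') * J h ^ (1 / p) := h1
      _ ≤ J g ^ (1 / p') * (J g * ‖h‖ ^ p) ^ (1 / p) := by
          gcongr
          · exact pairingFunctional_nonneg _
          · exact hmax h
      _ = J g * ‖h‖ := by
          rw [Real.mul_rpow hJ0 (by positivity), ← mul_assoc, ← Real.rpow_mul (norm_nonneg _),
            mul_one_div_cancel hp0.ne', Real.rpow_one,
            ← Real.rpow_add_of_nonneg hJ0 (one_div_nonneg.2 hpp.nonneg)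
              (one_div_nonneg.2 hp0.le), one_div, one_div, hpp.inv_add_inv_eq_one, Real.rpow_one]
  let ℓ : H →ₗ[ℝ] ℝ :=
    { toFun := fun h => ∫ x, ⟪θ x, g⟫ ^ (p - 1) * ⟪θ x, h⟫ ∂μ
      map_add' := fun a b => by
        rw [← integral_add (hint a) (hint b)]
        simp only [inner_add_right, mul_add]
      map_smul' := fun c a => by
        rw [RingHom.id_apply, smul_eq_mul, ← integral_const_mul]
        simp only [inner_smul_right, mul_left_comm] }
  set v := (InnerProductSpace.toDual ℝ H).symm (ℓ.mkContinuous (J g) hbound) with hv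
  have hvin : ∀ h, ⟪v, h⟫ = ∫ x, ⟪θ x, g⟫ ^ (p - 1) * ⟪θ x, h⟫ ∂μ := fun h => by
    rw [hv, InnerProductSpace.toDual_symm_apply]
    rfl
  have hvn : ‖v‖ ≤ J g := by
    rw [hv, LinearIsometryEquiv.norm_map]
    exact LinearMap.mkContinuous_norm_le _ hJ0 _
  have hvg : ⟪v, g⟫ = J g := by
    rw [hvin]
    refine integral_congr_ae (hpos.mono fun x hx => ?_)
    simp only [abs_of_nonneg hx]
    rw [← Real.rpow_add_one' hx (by linarith), sub_add_cancel]
  -- Instead of differentiating the functional: ‖v‖ ≤ J g, ⟨v, g⟩ = J g and ‖g‖ ≤ 1 force ‖v - J g •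
  -- g‖² ≤ 0, the equality case of Cauchy-Schwarz.
  have hz : v = J g • g := by
    rw [← sub_eq_zero, ← norm_eq_zero, ← sq_eq_zero_iff]
    refine le_antisymm ?_ (sq_nonneg _)
    rw [norm_sub_sq_real, inner_smul_right, hvg, norm_smul, Real.norm_of_nonneg hJ0]
    have h1 : ‖v‖ ^ 2 ≤ J g ^ 2 := by gcongr
    have h2 : (J g * ‖g‖) ^ 2 ≤ (J g * 1) ^ 2 := by gcongr
    nlinarith
  refine ⟨hint h, ?_⟩
  rw [← hvin, hz, inner_smul_left]
  rfl

end Variational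

/-! ### Model functions and their comparison -/

section ModelFunction

variable {ψ σ : ℝ → ℝ}

theorem IsModelFunction.contDiffAt (hψ : IsModelFunction ψ) {r : ℝ} (hr : 0 < r) :
    ContDiffAt ℝ ∞ ψ r :=
  hψ.smooth.contDiffAt (Ici_mem_nhds hr)

theorem IsModelFunction.hasDerivAt (hψ : IsModelFunction ψ) {r : ℝ} (hr : 0 < r) :
    HasDerivAt ψ (deriv ψ r) r :=
  ((hψ.contDiffAt hr).differentiableAt (by simp)).hasDerivAt

theorem IsModelFunction.continuousOn (hψ : IsModelFunction ψ) : ContinuousOn ψ (Ici 0) :=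
  hψ.smooth.continuousOn

theorem IsModelFunction.tendsto_div_nhdsGT (hψ : IsModelFunction ψ) :
    Tendsto (fun r => ψ r / r) (𝓝[>] 0) (𝓝 1) := by
  have h1 : HasDerivWithinAt ψ 1 (Ici 0) 0 := by
    rw [← hψ.deriv_zero]
    exact ((hψ.smooth.differentiableOn (by simp)) 0 self_mem_Ici).hasDerivWithinAt
  have h2 := hasDerivWithinAt_iff_tendsto_slope.1 h1
  have h3 : Ici (0 : ℝ) \ {0} = Ioi 0 := by
    ext x; simp [lt_iff_le_and_ne, eq_comm]
  rw [h3] at h2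
  refine h2.congr fun r => ?_
  simp [slope_def_field, hψ.zero]

theorem IsModelFunction.tendsto_deriv_nhdsGT (hψ : IsModelFunction ψ) :
    Tendsto (deriv ψ) (𝓝[>] 0) (𝓝 1) := by
  have h1 : ContinuousOn (derivWithin ψ (Ici 0)) (Ici 0) :=
    hψ.smooth.continuousOn_derivWithin (uniqueDiffOn_Ici 0) (by simp)
  have h2 : Tendsto (derivWithin ψ (Ici 0)) (𝓝[>] 0) (𝓝 1) := by
    rw [← hψ.deriv_zero]
    exact (h1 0 self_mem_Ici).mono Ioi_subset_Ici_self
  refine h2.congr' ?_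
  filter_upwards [self_mem_nhdsWithin] with r hr
  exact derivWithin_of_mem_nhds (Ici_mem_nhds hr)

theorem IsModelFunction.exists_half_le_le_two_mul (hψ : IsModelFunction ψ) :
    ∃ r₀ : ℝ, 0 < r₀ ∧ r₀ ≤ 1 ∧ ∀ r, 0 < r → r ≤ r₀ → r / 2 ≤ ψ r ∧ ψ r ≤ 2 * r := by
  have h := hψ.tendsto_div_nhdsGT.eventually (Icc_mem_nhds (a := 1 / 2) (b := 2)
    (by norm_num) (by norm_num))
  obtain ⟨b, hb, hb'⟩ := mem_nhdsGT_iff_exists_Ioc_subset.1 h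
  refine ⟨min b 1, lt_min hb one_pos, min_le_right _ _, fun r hr hr' => ?_⟩
  have h1 := hb' ⟨hr, hr'.trans (min_le_left _ _)⟩
  simp only [Set.mem_ofPred_eq, le_div_iff₀ hr, div_le_iff₀ hr] at h1
  exact ⟨by linarith [h1.1], h1.2⟩

theorem monotoneOn_div_of_deriv_div_le (hψ : IsModelFunction ψ) (hσ : IsModelFunction σ)
    (hψσ : ∀ r : ℝ, 0 < r → deriv σ r / σ r ≤ deriv ψ r / ψ r) :
    MonotoneOn (fun r => ψ r / σ r) (Ioi 0) := by
  have hd : ∀ r : ℝ, 0 < r → HasDerivAt (fun r => ψ r / σ r)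
      ((deriv ψ r * σ r - ψ r * deriv σ r) / σ r ^ 2) r := fun r hr =>
    (hψ.hasDerivAt hr).div (hσ.hasDerivAt hr) (hσ.pos r hr).ne'
  refine monotoneOn_of_deriv_nonneg (convex_Ioi 0)
    (fun r hr => (hd r hr).continuousAt.continuousWithinAt)
    (fun r hr => (hd r (interior_subset hr)).differentiableAt.differentiableWithinAt)
    fun r hr => ?_
  have hr' : 0 < r := interior_subset hr
  rw [(hd r hr').deriv]
  have h := hψσ r hr'
  rw [div_le_div_iff₀ (hσ.pos r hr') (hψ.pos r hr')] at h
  exact div_nonneg (by linarith) (sq_nonneg _)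

/-- Both functions have slope 1 at the origin, so the nondecreasing quotient starts from the limit
1. -/
theorem one_le_div_of_deriv_div_le (hψ : IsModelFunction ψ) (hσ : IsModelFunction σ)
    (hψσ : ∀ r : ℝ, 0 < r → deriv σ r / σ r ≤ deriv ψ r / ψ r) {r : ℝ} (hr : 0 < r) :
    1 ≤ ψ r / σ r := by
  have h1 : Tendsto (fun r => ψ r / σ r) (𝓝[>] 0) (𝓝 1) := by
    have := hψ.tendsto_div_nhdsGT.div hσ.tendsto_div_nhdsGT one_ne_zero
    rw [div_one] at this
    refine this.congr' ?_
    filter_upwards [self_mem_nhdsWithin] with s hs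
    simp only [Pi.div_apply]
    rw [div_div_div_cancel_right₀ (ne_of_gt hs)]
  refine le_of_tendsto h1 ?_
  filter_upwards [Ioo_mem_nhdsGT hr] with s hs
  exact monotoneOn_div_of_deriv_div_le hψ hσ hψσ hs.1 hr hs.2.le

end ModelFunction

/-! ### The Green function at the origin and at infinity -/

section Tail

/-- `∫_r^∞ ψ ^ (1 - n)`, the Green function of the radial Laplacian with pole at the origin. -/
noncomputable def radialGreen (n : ℕ) (ψ : ℝ → ℝ) (r : ℝ) : ℝ :=
  ∫ s in Ioi r, (ψ s ^ (n - 1))⁻¹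

/-- Growth at infinity: the part of the comparison with `σ` that the estimates use. -/
def HasTailBound (n : ℕ) (ψ : ℝ → ℝ) (a : ℝ) : Prop :=
  ∃ R C₁ C₂ : ℝ, ∃ D : ℝ → ℝ, 1 ≤ R ∧ 0 < C₁ ∧ 0 < C₂ ∧ (∀ r, R ≤ r → 1 ≤ D r) ∧
    (∀ r s, R ≤ r → r ≤ s → (ψ s ^ (n - 1))⁻¹ ≤ (D r)⁻¹ * (C₁ * s ^ (-a))) ∧
    ∀ r, R ≤ r → ψ r ^ (n - 1) ≤ D r * (C₂ * r ^ a)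

variable {n : ℕ} {ψ σ : ℝ → ℝ} {a p β : ℝ}

/-- The factor `D` is (ψ/σ)^(n-1), which may be unbounded. As ψ/σ is nondecreasing, its value at `r`
bounds it from below on [r, ∞), while at `r` itself it measures ψ exactly against σ. -/
theorem hasTailBound_of_deriv_div_le {α : ℝ} (hn : 2 ≤ n) (hψ : IsModelFunction ψ)
    (hσ : IsModelFunction σ)
    (hσ_growth : ∃ κ₁ κ₂ : ℝ, 0 < κ₁ ∧ 0 < κ₂ ∧
      ∀ᶠ r in atTop, κ₁ * r ^ α ≤ σ r ∧ σ r ≤ κ₂ * r ^ α)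
    (hψσ : ∀ r : ℝ, 0 < r → deriv σ r / σ r ≤ deriv ψ r / ψ r) :
    HasTailBound n ψ (α * ((n : ℝ) - 1)) := by
  obtain ⟨κ₁, κ₂, h1, h2, hev⟩ := hσ_growth
  obtain ⟨R₀, hR₀⟩ := eventually_atTop.1 hev
  have hcast : ((n - 1 : ℕ) : ℝ) = (n : ℝ) - 1 := by
    rw [Nat.cast_sub (by omega)]; simp
  have hpow : ∀ r : ℝ, 0 < r → r ^ (α * ((n : ℝ) - 1)) = (r ^ α) ^ (n - 1) := fun r hr => by
    rw [← hcast, Real.rpow_mul hr.le, Real.rpow_natCast]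
  refine ⟨max R₀ 1, (κ₁ ^ (n - 1))⁻¹, κ₂ ^ (n - 1), fun r => (ψ r / σ r) ^ (n - 1),
    le_max_right _ _, by positivity, by positivity, fun r hr => ?_, fun r s hr hs => ?_,
    fun r hr => ?_⟩
  · exact one_le_pow₀ (one_le_div_of_deriv_div_le hψ hσ hψσ
      (one_pos.trans_le ((le_max_right _ _).trans hr)))
  · have hr0 : 0 < r := one_pos.trans_le ((le_max_right _ _).trans hr)
    have hs0 : 0 < s := hr0.trans_le hs
    have hσs := (hR₀ s ((le_max_left _ _).trans (hr.trans hs))).1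
    have hmono : ψ r / σ r ≤ ψ s / σ s :=
      monotoneOn_div_of_deriv_div_le hψ hσ hψσ hr0 hs0 hs
    have hpos : 0 < ψ r / σ r := div_pos (hψ.pos r hr0) (hσ.pos r hr0)
    rw [Real.rpow_neg hs0.le, hpow s hs0, ← mul_inv, ← mul_inv, ← mul_pow, ← mul_pow]
    have hsα : 0 < s ^ α := Real.rpow_pos_of_pos hs0 _
    refine inv_anti₀ (by positivity) (pow_le_pow_left₀ (by positivity) ?_ _)
    calc ψ r / σ r * (κ₁ * s ^ α) ≤ ψ s / σ s * σ s :=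
          mul_le_mul hmono hσs (by positivity) (hpos.le.trans hmono)
      _ = ψ s := div_mul_cancel₀ _ (hσ.pos s hs0).ne'
  · have hr0 : 0 < r := one_pos.trans_le ((le_max_right _ _).trans hr)
    have hσr := (hR₀ r ((le_max_left _ _).trans hr)).2
    have hpos : 0 < ψ r / σ r := div_pos (hψ.pos r hr0) (hσ.pos r hr0)
    simp only
    rw [hpow r hr0, ← mul_pow, ← mul_pow]
    refine pow_le_pow_left₀ (hψ.pos r hr0).le ?_ _
    calc ψ r = ψ r / σ r * σ r := (div_mul_cancel₀ _ (hσ.pos r hr0).ne').symm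
      _ ≤ ψ r / σ r * (κ₂ * r ^ α) := by gcongr

theorem IsModelFunction.pow_pos (hψ : IsModelFunction ψ) {r : ℝ} (hr : 0 < r) :
    0 < ψ r ^ (n - 1) := _root_.pow_pos (hψ.pos r hr) _

theorem IsModelFunction.continuousOn_pow (hψ : IsModelFunction ψ) :
    ContinuousOn (fun r => ψ r ^ (n - 1)) (Ioi 0) :=
  (hψ.continuousOn.mono Ioi_subset_Ici_self).pow _

theorem IsModelFunction.continuousOn_inv_pow (hψ : IsModelFunction ψ) :
    ContinuousOn (fun r => (ψ r ^ (n - 1))⁻¹) (Ioi 0) :=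
  hψ.continuousOn_pow.inv₀ fun _ hr => (hψ.pow_pos hr).ne'

theorem integrableOn_Ioi_inv_pow (hψ : IsModelFunction ψ) (ht : HasTailBound n ψ a) (ha : 1 < a)
    {r : ℝ} (hr : 0 < r) : IntegrableOn (fun s => (ψ s ^ (n - 1))⁻¹) (Ioi r) := by
  obtain ⟨R, C₁, C₂, D, hR, hC₁, -, hD, hlow, -⟩ := ht
  have h1 : IntegrableOn (fun s => (ψ s ^ (n - 1))⁻¹) (Ioi R) := by
    have hmaj : IntegrableOn (fun s => (D R)⁻¹ * (C₁ * s ^ (-a))) (Ioi R) :=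
      ((integrableOn_Ioi_rpow_of_lt (by linarith) (by linarith)).const_mul _).const_mul _
    refine Integrable.mono' hmaj ((hψ.continuousOn_inv_pow.mono
      (Ioi_subset_Ioi (by linarith))).aestronglyMeasurable measurableSet_Ioi) ?_
    filter_upwards [ae_restrict_mem measurableSet_Ioi] with s hs
    rw [Real.norm_of_nonneg (inv_nonneg.2 (hψ.pow_pos (by linarith [mem_Ioi.1 hs])).le)]
    exact hlow R s le_rfl (le_of_lt hs)
  have h2 : IntegrableOn (fun s => (ψ s ^ (n - 1))⁻¹) (Icc r (max r R)) :=
    (hψ.continuousOn_inv_pow.mono fun s hs => hr.trans_le hs.1).integrableOn_Icc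
  refine (h2.union h1).mono_set fun s hs => ?_
  rcases le_or_gt s R with h | h
  · exact Or.inl ⟨le_of_lt hs, h.trans (le_max_right _ _)⟩
  · exact Or.inr h

theorem radialGreen_nonneg (hψ : IsModelFunction ψ) {r : ℝ} (hr : 0 ≤ r) :
    0 ≤ radialGreen n ψ r :=
  setIntegral_nonneg measurableSet_Ioi fun _ hs =>
    inv_nonneg.2 (hψ.pow_pos (hr.trans_lt hs)).le

theorem antitoneOn_radialGreen (hψ : IsModelFunction ψ) (ht : HasTailBound n ψ a) (ha : 1 < a) :
    AntitoneOn (radialGreen n ψ) (Ioi 0) := fun _ hr _ _ hrs =>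
  setIntegral_mono_set (integrableOn_Ioi_inv_pow hψ ht ha hr)
    (ae_restrict_of_forall_mem measurableSet_Ioi fun _ ht =>
      inv_nonneg.2 (hψ.pow_pos (lt_trans hr ht)).le)
    (Ioi_subset_Ioi hrs).eventuallyLE

theorem aemeasurable_radialGreen (hψ : IsModelFunction ψ) (ht : HasTailBound n ψ a) (ha : 1 < a) :
    AEMeasurable (radialGreen n ψ) (volume.restrict (Ioi 0)) :=
  aemeasurable_restrict_of_antitoneOn measurableSet_Ioi (antitoneOn_radialGreen hψ ht ha)

/-- Near 0 the integrand is at most a multiple of s^(1-n), which suggests r^(2-n) when n ≥ 3 and a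
logarithm when n = 2. Any exponent 2β > n - 2 covers both cases at once, and since r^(-2β) ≥ 1 it
also absorbs the part of the integral beyond `r₀`. -/
theorem exists_radialGreen_le_rpow (hψ : IsModelFunction ψ) (ht : HasTailBound n ψ a) (ha : 1 < a)
    (hn : 2 ≤ n) (hβ : ((n : ℝ) - 2) / 2 < β) {r₀ : ℝ} (hr₀ : 0 < r₀) (hr₀1 : r₀ ≤ 1)
    (hlow : ∀ r, 0 < r → r ≤ r₀ → r / 2 ≤ ψ r) :
    ∃ C, 0 < C ∧ ∀ r, 0 < r → r ≤ r₀ → radialGreen n ψ r ≤ C * r ^ (-(2 * β)) := by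
  have hn' : (2 : ℝ) ≤ n := by exact_mod_cast hn
  have hβ0 : 0 < β := by linarith
  have hcast : ((n - 1 : ℕ) : ℝ) = (n : ℝ) - 1 := by
    rw [Nat.cast_sub (by omega)]; simp
  refine ⟨2 ^ (n - 1) * (2 * β)⁻¹ + radialGreen n ψ r₀, ?_, fun r hr hrr => ?_⟩
  · have := radialGreen_nonneg (n := n) hψ hr₀.le
    positivity
  have hint := integrableOn_Ioi_inv_pow hψ ht ha hr
  have hsplit : radialGreen n ψ r =
      (∫ s in Ioc r r₀, (ψ s ^ (n - 1))⁻¹) + radialGreen n ψ r₀ := by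
    unfold radialGreen
    rw [← Ioc_union_Ioi_eq_Ioi hrr, setIntegral_union (Ioc_disjoint_Ioi le_rfl) measurableSet_Ioi
      (hint.mono_set Ioc_subset_Ioi_self) (hint.mono_set (Ioi_subset_Ioi hrr))]
  have hmaj : IntegrableOn (fun s : ℝ => 2 ^ (n - 1) * s ^ (-(2 * β) - 1)) (Ioi r) :=
    (integrableOn_Ioi_rpow_of_lt (by linarith) hr).const_mul _
  have h1 : ∫ s in Ioc r r₀, (ψ s ^ (n - 1))⁻¹ ≤ 2 ^ (n - 1) * ((2 * β)⁻¹ * r ^ (-(2 * β))) := by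
    calc ∫ s in Ioc r r₀, (ψ s ^ (n - 1))⁻¹
        ≤ ∫ s in Ioc r r₀, 2 ^ (n - 1) * s ^ (-(2 * β) - 1) := by
          refine setIntegral_mono_on (hint.mono_set Ioc_subset_Ioi_self)
            (hmaj.mono_set Ioc_subset_Ioi_self) measurableSet_Ioc fun s hs => ?_
          have hs0 : 0 < s := hr.trans hs.1
          calc (ψ s ^ (n - 1))⁻¹ ≤ ((s / 2) ^ (n - 1))⁻¹ :=
                inv_anti₀ (by positivity) (pow_le_pow_left₀ (by positivity) (hlow s hs0 hs.2) _)
            _ = 2 ^ (n - 1) * s ^ (-((n : ℝ) - 1)) := by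
                rw [Real.rpow_neg hs0.le, ← hcast, Real.rpow_natCast, div_pow, inv_div, div_eq_mul_inv]
            _ ≤ 2 ^ (n - 1) * s ^ (-(2 * β) - 1) := by
                gcongr 2 ^ (n - 1) * ?_
                exact Real.rpow_le_rpow_of_exponent_ge hs0 (hs.2.trans hr₀1) (by linarith)
      _ ≤ ∫ s in Ioi r, 2 ^ (n - 1) * s ^ (-(2 * β) - 1) := by
          refine setIntegral_mono_set hmaj ?_ Ioc_subset_Ioi_self.eventuallyLE
          refine ae_restrict_of_forall_mem measurableSet_Ioi fun s hs => ?_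
          have : 0 < s := hr.trans hs
          positivity
      _ = 2 ^ (n - 1) * ((2 * β)⁻¹ * r ^ (-(2 * β))) := by
          rw [integral_const_mul, integral_Ioi_rpow_of_lt (by linarith) hr]
          congr 1
          rw [sub_add_cancel]
          field_simp
  have h2 : radialGreen n ψ r₀ ≤ radialGreen n ψ r₀ * r ^ (-(2 * β)) := by
    refine le_mul_of_one_le_right (radialGreen_nonneg hψ hr₀.le) ?_
    exact Real.one_le_rpow_of_pos_of_le_one_of_nonpos hr (hrr.trans hr₀1) (by linarith)
  rw [hsplit]
  linarith

/-- This is the compactness estimate: the envelope G^(1/2) of the unit energy ball is in L^p. At the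
origin the integrand is at most a multiple of r^(n-1-βp). At infinity G ≲ D⁻¹ r^(1-a) and ψ^(n-1) ≲
D r^a, so the unknown growth enters only through D^(1-p/2) ≤ 1. -/
theorem integrableOn_radialGreen_rpow_mul (hn : 2 ≤ n) (hψ : IsModelFunction ψ)
    (ht : HasTailBound n ψ a) (ha : 1 < a) (hp : 2 < p) (hpa : 2 * (a + 1) / (a - 1) < p)
    (hβ : ((n : ℝ) - 2) / 2 < β) (hβp : β * p < n) :
    IntegrableOn (fun r => radialGreen n ψ r ^ (p / 2) * ψ r ^ (n - 1)) (Ioi 0) := by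
  have hmeas : ∀ s : Set ℝ, s ⊆ Ioi 0 → MeasurableSet s → AEStronglyMeasurable
      (fun r => radialGreen n ψ r ^ (p / 2) * ψ r ^ (n - 1)) (volume.restrict s) :=
    fun s hs hsm => ((((aemeasurable_radialGreen hψ ht ha).mono_set hs).pow_const _).mul
      ((hψ.continuousOn_pow.mono hs).aemeasurable hsm)).aestronglyMeasurable
  have hcast : ((n - 1 : ℕ) : ℝ) = (n : ℝ) - 1 := by
    rw [Nat.cast_sub (by omega)]; simp
  obtain ⟨r₀, hr₀, hr₀1, hb⟩ := hψ.exists_half_le_le_two_mul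
  obtain ⟨C, hC, hCb⟩ := exists_radialGreen_le_rpow hψ ht ha hn hβ hr₀ hr₀1 fun r h h' =>
    (hb r h h').1
  have hI1 : IntegrableOn (fun r => radialGreen n ψ r ^ (p / 2) * ψ r ^ (n - 1)) (Ioc 0 r₀) := by
    have hmaj : IntegrableOn (fun r : ℝ => C ^ (p / 2) * 2 ^ (n - 1) * r ^ ((n : ℝ) - 1 - β * p))
        (Ioc 0 r₀) := by
      refine Integrable.const_mul ?_ _
      exact (intervalIntegral.intervalIntegrable_rpow' (a := 0) (b := r₀)
        (r := (n : ℝ) - 1 - β * p) (by linarith)).1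
    refine Integrable.mono' hmaj (hmeas _ Ioc_subset_Ioi_self measurableSet_Ioc) ?_
    filter_upwards [ae_restrict_mem measurableSet_Ioc] with r hr
    have hG := radialGreen_nonneg (n := n) hψ hr.1.le
    have hw := (hψ.pow_pos (n := n) hr.1).le
    rw [Real.norm_of_nonneg (by positivity)]
    calc radialGreen n ψ r ^ (p / 2) * ψ r ^ (n - 1)
        ≤ (C * r ^ (-(2 * β))) ^ (p / 2) * (2 * r) ^ (n - 1) := by
          have := hr.1
          have := hψ.pos r hr.1
          gcongr
          · exact hCb r hr.1 hr.2
          · exact (hb r hr.1 hr.2).2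
      _ = C ^ (p / 2) * 2 ^ (n - 1) * r ^ ((n : ℝ) - 1 - β * p) := by
          have := hr.1
          rw [Real.mul_rpow hC.le (by positivity), ← Real.rpow_mul hr.1.le, mul_pow,
            ← Real.rpow_natCast r, hcast, sub_eq_neg_add ((n : ℝ) - 1), Real.rpow_add hr.1]
          rw [show -(2 * β) * (p / 2) = -(β * p) by ring]
          ring
  obtain ⟨R, C₁, C₂, D, hR, hC₁, hC₂, hD, hlow, hup⟩ := ht
  have ht : HasTailBound n ψ a := ⟨R, C₁, C₂, D, hR, hC₁, hC₂, hD, hlow, hup⟩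
  have hR0 : 0 < R := by linarith
  have hI2 : IntegrableOn (fun r => radialGreen n ψ r ^ (p / 2) * ψ r ^ (n - 1)) (Icc r₀ R) := by
    have hmaj : IntegrableOn (fun r => radialGreen n ψ r₀ ^ (p / 2) * ψ r ^ (n - 1))
        (Icc r₀ R) :=
      ((hψ.continuousOn_pow.mono fun s hs => hr₀.trans_le hs.1).integrableOn_Icc).const_mul _
    refine Integrable.mono' hmaj (hmeas _ (fun s hs => hr₀.trans_le hs.1) measurableSet_Icc) ?_
    filter_upwards [ae_restrict_mem measurableSet_Icc] with r hr
    have hr0 : 0 < r := hr₀.trans_le hr.1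
    have hG := radialGreen_nonneg (n := n) hψ hr0.le
    have hw := (hψ.pow_pos (n := n) hr0).le
    rw [Real.norm_of_nonneg (by positivity)]
    gcongr
    exact antitoneOn_radialGreen hψ ht ha hr₀ hr0 hr.1
  have hI3 : IntegrableOn (fun r => radialGreen n ψ r ^ (p / 2) * ψ r ^ (n - 1)) (Ioi R) := by
    -- The lower bound on `p`, rewritten as convergence of the tail integral.
    have hexp : a + (1 - a) * (p / 2) < -1 := by
      rw [div_lt_iff₀ (by linarith)] at hpa
      nlinarith
    have hmaj : IntegrableOn (fun r : ℝ => (C₁ / (a - 1)) ^ (p / 2) * C₂ *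
        r ^ (a + (1 - a) * (p / 2))) (Ioi R) :=
      (integrableOn_Ioi_rpow_of_lt hexp hR0).const_mul _
    refine Integrable.mono' hmaj (hmeas _ (Ioi_subset_Ioi hR0.le) measurableSet_Ioi) ?_
    filter_upwards [ae_restrict_mem measurableSet_Ioi] with r hr
    have hr0 : 0 < r := hR0.trans hr
    have hrR : R ≤ r := le_of_lt hr
    have hG := radialGreen_nonneg (n := n) hψ hr0.le
    have hw := (hψ.pow_pos (n := n) hr0).le
    have hDr := hD r hrR
    have hD0 : 0 < D r := by linarith
    have ha1 : 0 < a - 1 := by linarith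
    rw [Real.norm_of_nonneg (by positivity)]
    have hGr : radialGreen n ψ r ≤ (D r)⁻¹ * (C₁ / (a - 1) * r ^ (1 - a)) := by
      calc radialGreen n ψ r ≤ ∫ s in Ioi r, (D r)⁻¹ * (C₁ * s ^ (-a)) := by
            refine setIntegral_mono_on (integrableOn_Ioi_inv_pow hψ ht ha hr0)
              (((integrableOn_Ioi_rpow_of_lt (by linarith) hr0).const_mul _).const_mul _)
              measurableSet_Ioi fun s hs => hlow r s hrR (le_of_lt hs)
        _ = (D r)⁻¹ * (C₁ / (a - 1) * r ^ (1 - a)) := by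
            rw [integral_const_mul, integral_const_mul, integral_Ioi_rpow_of_lt (by linarith) hr0,
              show -a + 1 = 1 - a by ring, show (1 - a) = -(a - 1) by ring, neg_div_neg_eq]
            ring
    calc radialGreen n ψ r ^ (p / 2) * ψ r ^ (n - 1)
        ≤ ((D r)⁻¹ * (C₁ / (a - 1) * r ^ (1 - a))) ^ (p / 2) * (D r * (C₂ * r ^ a)) := by
          gcongr
          exact hup r hrR
      _ = D r ^ (1 - p / 2) * ((C₁ / (a - 1)) ^ (p / 2) * C₂ *
            r ^ (a + (1 - a) * (p / 2))) := by
          rw [Real.mul_rpow (by positivity) (by positivity),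
            Real.mul_rpow (by positivity) (by positivity), ← Real.rpow_mul hr0.le,
            Real.rpow_add hr0, Real.rpow_sub hD0, Real.rpow_one, Real.inv_rpow hD0.le]
          field_simp
      _ ≤ 1 * ((C₁ / (a - 1)) ^ (p / 2) * C₂ * r ^ (a + (1 - a) * (p / 2))) := by
          gcongr
          exact Real.rpow_le_one_of_one_le_of_nonpos hDr (by linarith)
      _ = _ := one_mul _
  refine ((hI1.union hI2).union hI3).mono_set fun r hr => ?_
  rcases le_or_gt r r₀ with h | h
  · exact Or.inl (Or.inl ⟨hr, h⟩)
  · rcases le_or_gt r R with h' | h'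
    · exact Or.inl (Or.inr ⟨h.le, h'⟩)
    · exact Or.inr h'

/-- The four conditions serve, in order, the bound on G near 0, the room above the final bootstrap
exponent 1/q, the integrability of G^((q+1)/2) ψ^(n-1) at 0, and a positive gain per bootstrap step.
They are compatible because both (n-2)/2 < n/(q+1) and (n-2)/2 < 2/(q-1) amount to (n-2)(q+1) < 2n,
which is subcriticality. -/
theorem exists_decay_exponent {q : ℝ} (hn : 2 ≤ n) (hq : 1 < q)
    (hq_upper : (q : EReal) < sobolevExponent n - 1) :
    ∃ β : ℝ, ((n : ℝ) - 2) / 2 < β ∧ 1 / q < β ∧ β * (q + 1) < n ∧ β * (q - 1) < 2 := by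
  have hn' : (2 : ℝ) ≤ n := by exact_mod_cast hn
  have hq0 : 0 < q := by linarith
  have hsub : ((n : ℝ) - 2) * (q + 1) < 2 * n := by
    rcases hn.eq_or_lt with rfl | h
    · norm_num
    · have h2 : (2 : ℝ) < n := by exact_mod_cast h
      rw [sobolevExponent, if_neg (by omega), ← EReal.coe_one, ← EReal.coe_sub,
        EReal.coe_lt_coe_iff, lt_sub_iff_add_lt, lt_div_iff₀ (by linarith)] at hq_upper
      linarith
  have hlt : max (((n : ℝ) - 2) / 2) (1 / q) < min (n / (q + 1)) (2 / (q - 1)) := by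
    rw [max_lt_iff, lt_min_iff, lt_min_iff]
    refine ⟨⟨?_, ?_⟩, ?_, ?_⟩
    · rw [div_lt_div_iff₀ two_pos (by linarith)]; linarith
    · rw [div_lt_div_iff₀ two_pos (by linarith)]; linarith
    · rw [div_lt_div_iff₀ hq0 (by linarith)]; nlinarith
    · rw [div_lt_div_iff₀ hq0 (by linarith)]; linarith
  obtain ⟨β, h1, h2⟩ := exists_between hlt
  rw [max_lt_iff] at h1
  rw [lt_min_iff, lt_div_iff₀ (by linarith), lt_div_iff₀ (by linarith)] at h2
  exact ⟨β, h1.1, h1.2, h2.1, h2.2⟩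

end Tail

/-! ### Evaluation functionals on weighted L² and the extremal -/

section RadialL2

open scoped RealInnerProductSpace

/-- The measure `ψ ^ (n - 1) dr` on `(0, ∞)`. -/
noncomputable def radialMeasure (n : ℕ) (ψ : ℝ → ℝ) : Measure ℝ :=
  (volume.restrict (Ioi 0)).withDensity fun r => ENNReal.ofReal (ψ r ^ (n - 1))

variable {n : ℕ} {ψ : ℝ → ℝ} {a p : ℝ}

theorem IsModelFunction.aemeasurable_ofReal_pow (hψ : IsModelFunction ψ) :
    AEMeasurable (fun r => ENNReal.ofReal (ψ r ^ (n - 1))) (volume.restrict (Ioi 0)) :=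
  (hψ.continuousOn_pow.aemeasurable measurableSet_Ioi).ennreal_ofReal

theorem radialMeasure_absolutelyContinuous :
    radialMeasure n ψ ≪ volume.restrict (Ioi 0) :=
  withDensity_absolutelyContinuous _ _

theorem IsModelFunction.absolutelyContinuous_radialMeasure (hψ : IsModelFunction ψ) :
    volume.restrict (Ioi 0) ≪ radialMeasure n ψ := by
  refine withDensity_absolutelyContinuous' hψ.aemeasurable_ofReal_pow ?_
  filter_upwards [ae_restrict_mem measurableSet_Ioi] with r hr
  simpa using hψ.pow_pos hr

theorem ae_radialMeasure_pos : ∀ᵐ r ∂(radialMeasure n ψ), 0 < r :=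
  radialMeasure_absolutelyContinuous.ae_le (ae_restrict_mem measurableSet_Ioi)

theorem IsModelFunction.integrable_radialMeasure_iff (hψ : IsModelFunction ψ) {f : ℝ → ℝ} :
    Integrable f (radialMeasure n ψ) ↔ IntegrableOn (fun r => ψ r ^ (n - 1) * f r) (Ioi 0) := by
  rw [radialMeasure, integrable_withDensity_iff_integrable_smul₀' hψ.aemeasurable_ofReal_pow
    (Eventually.of_forall fun _ => ENNReal.ofReal_lt_top)]
  refine integrable_congr ?_
  filter_upwards [ae_restrict_mem measurableSet_Ioi] with r hr
  rw [ENNReal.toReal_ofReal (hψ.pow_pos hr).le, smul_eq_mul]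

theorem IsModelFunction.integral_radialMeasure (hψ : IsModelFunction ψ) (f : ℝ → ℝ) :
    ∫ r, f r ∂(radialMeasure n ψ) = ∫ r in Ioi 0, ψ r ^ (n - 1) * f r := by
  rw [radialMeasure, integral_withDensity_eq_integral_toReal_smul₀ hψ.aemeasurable_ofReal_pow
    (Eventually.of_forall fun _ => ENNReal.ofReal_lt_top)]
  refine integral_congr_ae ?_
  filter_upwards [ae_restrict_mem measurableSet_Ioi] with r hr
  rw [ENNReal.toReal_ofReal (hψ.pow_pos hr).le, smul_eq_mul]

theorem IsModelFunction.aestronglyMeasurable_radialMeasure_iff (hψ : IsModelFunction ψ)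
    {f : ℝ → ℝ} : AEStronglyMeasurable f (radialMeasure n ψ) ↔
      AEStronglyMeasurable f (volume.restrict (Ioi 0)) :=
  ⟨fun h => h.mono_ac hψ.absolutelyContinuous_radialMeasure,
    fun h => h.mono_ac radialMeasure_absolutelyContinuous⟩

instance : SFinite (radialMeasure n ψ) := by unfold radialMeasure; infer_instance

/-- Squaring ψ^(1-n) and multiplying by the weight leaves ψ^(1-n), which is integrable on (r, ∞). -/
theorem IsModelFunction.memLp_indicator_inv_pow (hψ : IsModelFunction ψ) (ht : HasTailBound n ψ a)
    (ha : 1 < a) {r : ℝ} (hr : 0 < r) :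
    MemLp ((Ioi r).indicator fun s => (ψ s ^ (n - 1))⁻¹) 2 (radialMeasure n ψ) := by
  have hm : AEStronglyMeasurable ((Ioi r).indicator fun s => (ψ s ^ (n - 1))⁻¹)
      (radialMeasure n ψ) := by
    rw [hψ.aestronglyMeasurable_radialMeasure_iff]
    exact (hψ.continuousOn_inv_pow.aestronglyMeasurable measurableSet_Ioi).indicator
      measurableSet_Ioi
  rw [memLp_two_iff_integrable_sq hm, hψ.integrable_radialMeasure_iff]
  have h := (integrableOn_Ioi_inv_pow hψ ht ha hr).integrable_indicator measurableSet_Ioi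
  refine h.integrableOn.congr_fun (fun s hs => ?_) measurableSet_Ioi
  have := (hψ.pow_pos (n := n) hs).ne'
  by_cases h : s ∈ Ioi r
  · simp only [indicator_of_mem h]
    field_simp
  · simp [indicator_of_notMem h]

/-- The representative `1_{(r, ∞)} ψ ^ (1 - n)` of the functional `h ↦ ∫_r^∞ h` on
`L²(ψ ^ (n - 1) dr)`. -/
noncomputable def tailVector (n : ℕ) (ψ : ℝ → ℝ) (r : ℝ) : Lp ℝ 2 (radialMeasure n ψ) :=
  open Classical in
  if h : MemLp ((Ioi r).indicator fun s => (ψ s ^ (n - 1))⁻¹) 2 (radialMeasure n ψ) then h.toLp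
  else 0

theorem IsModelFunction.coeFn_tailVector (hψ : IsModelFunction ψ) (ht : HasTailBound n ψ a)
    (ha : 1 < a) {r : ℝ} (hr : 0 < r) :
    tailVector n ψ r =ᵐ[radialMeasure n ψ] (Ioi r).indicator fun s => (ψ s ^ (n - 1))⁻¹ := by
  rw [tailVector, dif_pos (hψ.memLp_indicator_inv_pow ht ha hr)]
  exact MemLp.coeFn_toLp _

/-- The weight cancels against ψ^(1-n); integrability of `h` on the tail is that of an L² pairing.
-/
theorem IsModelFunction.inner_tailVector (hψ : IsModelFunction ψ) (ht : HasTailBound n ψ a)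
    (ha : 1 < a) {r : ℝ} (hr : 0 < r) (h : Lp ℝ 2 (radialMeasure n ψ)) :
    IntegrableOn h (Ioi r) ∧ ⟪tailVector n ψ r, h⟫ = ∫ s in Ioi r, h s := by
  have hae := hψ.coeFn_tailVector ht ha hr
  have hI := L2.integrable_inner (𝕜 := ℝ) (tailVector n ψ r) h
  have hae' : ∀ᵐ s ∂(volume.restrict (Ioi 0)),
      ψ s ^ (n - 1) * ⟪tailVector n ψ r s, h s⟫ = (Ioi r).indicator h s := by
    filter_upwards [hψ.absolutelyContinuous_radialMeasure.ae_le hae,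
      ae_restrict_mem measurableSet_Ioi] with s hs hs0
    rw [hs]
    have := (hψ.pow_pos (n := n) hs0).ne'
    by_cases hsr : s ∈ Ioi r
    · simp only [indicator_of_mem hsr, RCLike.inner_apply, conj_trivial]
      field_simp
    · simp [indicator_of_notMem hsr]
  have hsub : Ioi r ⊆ Ioi 0 := Ioi_subset_Ioi hr.le
  constructor
  · rw [hψ.integrable_radialMeasure_iff] at hI
    have h1 : IntegrableOn ((Ioi r).indicator h) (Ioi 0) := (integrable_congr hae').1 hI
    rwa [IntegrableOn, integrable_indicator_iff measurableSet_Ioi, IntegrableOn,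
      Measure.restrict_restrict measurableSet_Ioi, inter_eq_left.2 hsub] at h1
  · rw [L2.inner_def, hψ.integral_radialMeasure, integral_congr_ae hae',
      integral_indicator measurableSet_Ioi, Measure.restrict_restrict measurableSet_Ioi,
      inter_eq_left.2 hsub]

/-- Two tails meet in the shorter one. Hence the Gram kernel of the evaluations is the Green kernel,
which turns the Euler-Lagrange equation into an integral equation. -/
theorem IsModelFunction.inner_tailVector_tailVector (hψ : IsModelFunction ψ)
    (ht : HasTailBound n ψ a) (ha : 1 < a) {r s : ℝ} (hr : 0 < r) (hs : 0 < s) :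
    ⟪tailVector n ψ r, tailVector n ψ s⟫ = radialGreen n ψ (max r s) := by
  rw [(hψ.inner_tailVector ht ha hr _).2]
  have hac : volume.restrict (Ioi r) ≪ radialMeasure n ψ :=
    (Measure.restrict_mono (Ioi_subset_Ioi hr.le) le_rfl).absolutelyContinuous.trans
      hψ.absolutelyContinuous_radialMeasure
  rw [integral_congr_ae (hac.ae_le (hψ.coeFn_tailVector ht ha hs)),
    integral_indicator measurableSet_Ioi, Measure.restrict_restrict measurableSet_Ioi,
    Ioi_inter_Ioi, sup_comm]
  rfl

theorem integral_Ioi_eq_sub_intervalIntegral {h : ℝ → ℝ} {b x : ℝ} (hi : IntegrableOn h (Ioi b))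
    (hx : b ≤ x) : ∫ s in Ioi x, h s = (∫ s in Ioi b, h s) - ∫ s in b..x, h s := by
  rw [← intervalIntegral.integral_Ioi_sub_Ioi hi hx, sub_sub_cancel]

theorem continuousOn_integral_Ioi {h : ℝ → ℝ} (hh : ∀ r, 0 < r → IntegrableOn h (Ioi r)) :
    ContinuousOn (fun r => ∫ s in Ioi r, h s) (Ioi 0) := by
  intro r hr
  refine ContinuousAt.continuousWithinAt ?_
  have hb : 0 < r / 2 := half_pos hr
  have hind : Integrable ((Ioi (r / 2)).indicator h) :=
    (integrable_indicator_iff measurableSet_Ioi).2 (hh _ hb)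
  have hc : ContinuousAt (fun x => (∫ s in Ioi (r / 2), h s) -
      ∫ s in (r / 2)..x, (Ioi (r / 2)).indicator h s) r :=
    (continuous_const.sub
      (intervalIntegral.continuous_primitive (fun _ _ => hind.intervalIntegrable) _)).continuousAt
  refine hc.congr ?_
  filter_upwards [Ioi_mem_nhds (half_lt_self hr)] with x hx
  have hx' : r / 2 ≤ x := le_of_lt hx
  rw [integral_Ioi_eq_sub_intervalIntegral (hh _ hb) hx', intervalIntegral.integral_of_le hx',
    intervalIntegral.integral_of_le hx', setIntegral_congr_fun (g := h) measurableSet_Ioc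
      fun s hs => indicator_of_mem (show s ∈ Ioi (r / 2) from hs.1) h]

theorem IsModelFunction.aestronglyMeasurable_inner_tailVector (hψ : IsModelFunction ψ)
    (ht : HasTailBound n ψ a) (ha : 1 < a) (h : Lp ℝ 2 (radialMeasure n ψ)) :
    AEStronglyMeasurable (fun r => ⟪tailVector n ψ r, h⟫) (radialMeasure n ψ) := by
  rw [hψ.aestronglyMeasurable_radialMeasure_iff]
  refine ((continuousOn_integral_Ioi fun r hr =>
    (hψ.inner_tailVector ht ha hr h).1).aestronglyMeasurable measurableSet_Ioi).congr ?_
  filter_upwards [ae_restrict_mem measurableSet_Ioi] with r hr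
  exact (hψ.inner_tailVector ht ha hr h).2.symm

theorem IsModelFunction.norm_tailVector (hψ : IsModelFunction ψ)
    (ht : HasTailBound n ψ a) (ha : 1 < a) {r : ℝ} (hr : 0 < r) :
    ‖tailVector n ψ r‖ = radialGreen n ψ r ^ (1 / 2 : ℝ) := by
  rw [norm_eq_sqrt_real_inner, hψ.inner_tailVector_tailVector ht ha hr hr, max_self,
    Real.sqrt_eq_rpow]

theorem radialGreen_pos (hψ : IsModelFunction ψ) (ht : HasTailBound n ψ a) (ha : 1 < a) {r : ℝ}
    (hr : 0 < r) : 0 < radialGreen n ψ r := by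
  refine (setIntegral_pos_iff_support_of_nonneg_ae
    (ae_restrict_of_forall_mem measurableSet_Ioi fun s hs =>
      inv_nonneg.2 (hψ.pow_pos (hr.trans hs)).le) (integrableOn_Ioi_inv_pow hψ ht ha hr)).2 ?_
  have : Ioi r ⊆ Function.support (fun s => (ψ s ^ (n - 1))⁻¹) ∩ Ioi r := fun s hs =>
    ⟨inv_ne_zero (hψ.pow_pos (hr.trans hs)).ne', hs⟩
  refine lt_of_lt_of_le ?_ (measure_mono this)
  simp

theorem radialMeasure_ne_zero (hψ : IsModelFunction ψ) : radialMeasure n ψ ≠ 0 := by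
  intro h
  have := hψ.absolutelyContinuous_radialMeasure (n := n)
  rw [h, Measure.absolutelyContinuous_zero_iff, Measure.restrict_eq_zero] at this
  simp at this

/-- A nonnegative extremal of the Sobolev inequality, in terms of the derivative `-g`, with its
integral Euler-Lagrange equation. -/
theorem IsModelFunction.exists_extremal (hψ : IsModelFunction ψ) (ht : HasTailBound n ψ a)
    (ha : 1 < a) (hp : 2 < p)
    (hint : IntegrableOn (fun r => radialGreen n ψ r ^ (p / 2) * ψ r ^ (n - 1)) (Ioi 0)) :
    ∃ g : Lp ℝ 2 (radialMeasure n ψ), ∃ m : ℝ, ‖g‖ = 1 ∧ 0 < m ∧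
      (∀ᵐ s ∂(radialMeasure n ψ), 0 ≤ g s) ∧
      m = pairingFunctional (radialMeasure n ψ) (tailVector n ψ) p g ∧
      (∀ h, pairingFunctional (radialMeasure n ψ) (tailVector n ψ) p h ≤ m * ‖h‖ ^ p) ∧
      (∀ h, Integrable (fun r => |⟪tailVector n ψ r, h⟫| ^ p) (radialMeasure n ψ)) ∧
      ∀ r, 0 < r → IntegrableOn (fun s => ψ s ^ (n - 1) *
          ((∫ t in Ioi s, g t) ^ (p - 1) * radialGreen n ψ (max s r))) (Ioi 0) ∧
        ∫ s in Ioi 0, ψ s ^ (n - 1) *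
          ((∫ t in Ioi s, g t) ^ (p - 1) * radialGreen n ψ (max s r)) =
          m * ∫ t in Ioi r, g t := by
  have hp0 : 0 < p := by linarith
  -- Finiteness of the exponent gives the separability of L² that sequential weak compactness
  -- requires.
  have : Fact ((2 : ℝ≥0∞) ≠ ⊤) := ⟨ENNReal.ofNat_ne_top⟩
  have hmeas := hψ.aestronglyMeasurable_inner_tailVector ht ha
  have hB : ∀ᵐ r ∂(radialMeasure n ψ), ‖tailVector n ψ r‖ ≤ radialGreen n ψ r ^ (1 / 2 : ℝ) :=
    ae_radialMeasure_pos.mono fun r hr => (hψ.norm_tailVector ht ha hr).le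
  have hBp : Integrable (fun r => (radialGreen n ψ r ^ (1 / 2 : ℝ)) ^ p) (radialMeasure n ψ) := by
    rw [hψ.integrable_radialMeasure_iff]
    refine hint.congr_fun (fun r hr => ?_) measurableSet_Ioi
    simp only
    rw [← Real.rpow_mul (radialGreen_nonneg hψ (le_of_lt hr)), one_div_mul_eq_div, mul_comm]
  obtain ⟨g₀, hg₀, hmax₀⟩ := exists_forall_pairingFunctional_le hp0 hmeas hB hBp
  set J := pairingFunctional (radialMeasure n ψ) (tailVector n ψ) p with hJ
  have hI := integrable_abs_inner_rpow hp0.le hmeas hB hBp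
  have habs : ∀ᵐ s ∂(radialMeasure n ψ), |g₀| s = |g₀ s| := Lp.coeFn_abs g₀
  have habs' : ∀ r, 0 < r → ∫ s in Ioi r, |g₀| s = ∫ s in Ioi r, |g₀ s| := fun r hr => by
    have hac : volume.restrict (Ioi r) ≪ radialMeasure n ψ :=
      (Measure.restrict_mono (Ioi_subset_Ioi hr.le) le_rfl).absolutelyContinuous.trans
        hψ.absolutelyContinuous_radialMeasure
    exact integral_congr_ae (hac.ae_le habs)
  have hpos : ∀ᵐ r ∂(radialMeasure n ψ), 0 ≤ ⟪tailVector n ψ r, |g₀|⟫ := by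
    filter_upwards [ae_radialMeasure_pos] with r hr
    rw [(hψ.inner_tailVector ht ha hr _).2, habs' r hr]
    exact integral_nonneg fun _ => abs_nonneg _
  -- Passing to the absolute value keeps the norm and can only enlarge every tail integral.
  have hJle : J g₀ ≤ J |g₀| := by
    refine integral_mono_ae (hI g₀) (hI |g₀|) ?_
    filter_upwards [ae_radialMeasure_pos, hpos] with r hr hr'
    refine Real.rpow_le_rpow (abs_nonneg _) ?_ hp0.le
    rw [abs_of_nonneg hr', (hψ.inner_tailVector ht ha hr _).2, (hψ.inner_tailVector ht ha hr _).2,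
      habs' r hr]
    exact abs_integral_le_integral_abs
  have hnorm : ‖|g₀|‖ ≤ 1 := by rwa [norm_abs_eq_norm]
  have hmax : ∀ h, J h ≤ J |g₀| * ‖h‖ ^ p := fun h =>
    (hmax₀ h).trans (by gcongr)
  -- The test vector θ_1 has the strictly positive pairings G(max r 1), so a zero maximum is
  -- impossible.
  have hJpos : 0 < J |g₀| := by
    have h1 : 0 < J (tailVector n ψ 1) := by
      refine (integral_pos_iff_support_of_nonneg_ae (Eventually.of_forall fun _ => by positivity)
        (hI _)).2 ?_
      rw [pos_iff_ne_zero]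
      intro h0
      apply radialMeasure_ne_zero (n := n) hψ
      rw [← ae_eq_bot, ← Filter.eventually_false_iff_eq_bot]
      have h2 : ∀ᵐ r ∂(radialMeasure n ψ), |⟪tailVector n ψ r, tailVector n ψ 1⟫| ^ p = 0 := by
        rw [ae_iff]
        exact h0
      filter_upwards [h2, ae_radialMeasure_pos] with r hr hr0
      rw [hψ.inner_tailVector_tailVector ht ha hr0 one_pos] at hr
      have := radialGreen_pos hψ ht ha (lt_max_of_lt_left hr0 : 0 < max r 1)
      exact absurd hr (Real.rpow_pos_of_pos (abs_pos.2 this.ne') _).ne'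
    by_contra hcon
    have h3 := hmax (tailVector n ψ 1)
    have h4 : J |g₀| = 0 := le_antisymm (not_lt.1 hcon) (pairingFunctional_nonneg _)
    rw [h4, zero_mul] at h3
    linarith
  refine ⟨|g₀|, J |g₀|, le_antisymm hnorm ?_, hJpos, habs.mono fun s hs => hs ▸ abs_nonneg _, rfl,
    hmax, hI, fun r hr => ?_⟩
  -- With norm below 1, maximality applied to the maximizer itself would give J < J.
  · by_contra hlt
    have h1 := hmax |g₀|
    have h2 : ‖|g₀|‖ ^ p < 1 := Real.rpow_lt_one (norm_nonneg _) (not_le.1 hlt) hp0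
    nlinarith
  · have hEL := integral_inner_rpow_mul_inner_eq (by linarith : 1 < p) hmeas hB hBp hnorm hmax
      hpos (tailVector n ψ r)
    have hcong : ∀ s ∈ Ioi (0 : ℝ), ψ s ^ (n - 1) * (⟪tailVector n ψ s, |g₀|⟫ ^ (p - 1) *
        ⟪tailVector n ψ s, tailVector n ψ r⟫) = ψ s ^ (n - 1) *
          ((∫ t in Ioi s, |g₀| t) ^ (p - 1) * radialGreen n ψ (max s r)) := fun s hs => by
      rw [hψ.inner_tailVector_tailVector ht ha hs hr, (hψ.inner_tailVector ht ha hs _).2]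
    rw [hψ.integrable_radialMeasure_iff, hψ.integral_radialMeasure] at hEL
    rw [setIntegral_congr_fun measurableSet_Ioi hcong, real_inner_comm,
      (hψ.inner_tailVector ht ha hr _).2] at hEL
    exact ⟨hEL.1.congr_fun hcong measurableSet_Ioi, hEL.2⟩

end RadialL2

/-! ### Differentiating tail integrals -/

section Primitive

theorem hasDerivAt_integral_Ioi {h : ℝ → ℝ} (hc : ContinuousOn h (Ioi 0))
    (hi : ∀ r, 0 < r → IntegrableOn h (Ioi r)) {r : ℝ} (hr : 0 < r) :
    HasDerivAt (fun x => ∫ s in Ioi x, h s) (-h r) r := by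
  have hb : 0 < r / 2 := half_pos hr
  have hint : ∀ x, r / 2 < x → IntervalIntegrable h volume (r / 2) x := fun x hx =>
    (intervalIntegrable_iff_integrableOn_Ioc_of_le hx.le).2
      ((hi _ hb).mono_set Ioc_subset_Ioi_self)
  have h1 : HasDerivAt (fun x => (∫ s in Ioi (r / 2), h s) - ∫ s in (r / 2)..x, h s) (-h r) r := by
    have hm : StronglyMeasurableAtFilter h (𝓝 r) volume :=
      hc.stronglyMeasurableAtFilter isOpen_Ioi r hr
    simpa using (intervalIntegral.integral_hasDerivAt_right (hint r (half_lt_self hr)) hm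
      (hc.continuousAt (Ioi_mem_nhds hr))).const_sub (∫ s in Ioi (r / 2), h s)
  refine h1.congr_of_eventuallyEq ?_
  filter_upwards [Ioi_mem_nhds (half_lt_self hr)] with x hx
  exact integral_Ioi_eq_sub_intervalIntegral (hi _ hb) (le_of_lt hx)

theorem hasDerivAt_integral_zero {h : ℝ → ℝ} (hc : ContinuousOn h (Ioi 0))
    (hi : ∀ r, 0 < r → IntervalIntegrable h volume 0 r) {r : ℝ} (hr : 0 < r) :
    HasDerivAt (fun x => ∫ s in 0..x, h s) (h r) r :=
  intervalIntegral.integral_hasDerivAt_right (hi r hr)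
    (hc.stronglyMeasurableAtFilter isOpen_Ioi r hr) (hc.continuousAt (Ioi_mem_nhds hr))

/-- Since `h` need not be integrable at 0, Lebesgue differentiation is applied to its truncations to
(1/(k+1), ∞), and countably many null sets are discarded. -/
theorem ae_hasDerivAt_integral_Ioi {h : ℝ → ℝ} (hi : ∀ r, 0 < r → IntegrableOn h (Ioi r)) :
    ∀ᵐ x ∂(volume.restrict (Ioi 0)), HasDerivAt (fun r => ∫ s in Ioi r, h s) (-h x) x := by
  have key : ∀ k : ℕ, ∀ᵐ x, ∀ c, HasDerivAt
      (fun x => ∫ t in c..x, (Ioi (1 / ((k : ℝ) + 1))).indicator h t)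
      ((Ioi (1 / ((k : ℝ) + 1))).indicator h x) x := fun k =>
    LocallyIntegrable.ae_hasDerivAt_integral (Integrable.locallyIntegrable
      ((integrable_indicator_iff measurableSet_Ioi).2
        (hi (1 / ((k : ℝ) + 1)) (by positivity))))
  filter_upwards [ae_restrict_of_ae (ae_all_iff.2 key), ae_restrict_mem measurableSet_Ioi]
    with x hx hx0
  obtain ⟨k, hk⟩ := exists_nat_one_div_lt (mem_Ioi.1 hx0)
  set b := 1 / ((k : ℝ) + 1) with hb
  have hb0 : 0 < b := by positivity
  have h1 := (hx k b).const_sub (∫ s in Ioi b, h s)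
  rw [indicator_of_mem (show x ∈ Ioi b from hk)] at h1
  refine h1.congr_of_eventuallyEq ?_
  filter_upwards [Ioi_mem_nhds hk] with y hy
  have hy' : b ≤ y := le_of_lt hy
  rw [integral_Ioi_eq_sub_intervalIntegral (hi _ hb0) hy', intervalIntegral.integral_of_le hy',
    intervalIntegral.integral_of_le hy', setIntegral_congr_fun (g := h) measurableSet_Ioc
      fun s hs => indicator_of_mem (show s ∈ Ioi b from hs.1) h]

end Primitive

/-! ### From the Green representation to the differential equation -/

section GreenRepresentation

variable {n : ℕ} {ψ f : ℝ → ℝ} {a q m : ℝ}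

/-- On (0, r] the kernel is the positive constant G(r), which can be divided out. -/
theorem IsModelFunction.intervalIntegrable_of_green (hψ : IsModelFunction ψ)
    (ht : HasTailBound n ψ a) (ha : 1 < a)
    (hint : ∀ r, 0 < r → IntegrableOn
      (fun s => ψ s ^ (n - 1) * (f s ^ q * radialGreen n ψ (max s r))) (Ioi 0)) {r : ℝ}
    (hr : 0 < r) : IntervalIntegrable (fun s => ψ s ^ (n - 1) * f s ^ q) volume 0 r := by
  rw [intervalIntegrable_iff_integrableOn_Ioc_of_le hr.le]
  have h1 := ((hint r hr).mono_set Ioc_subset_Ioi_self : IntegrableOn _ (Ioc 0 r)).mul_const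
    (radialGreen n ψ r)⁻¹
  refine IntegrableOn.congr_fun h1 (fun s hs => ?_) measurableSet_Ioc
  have := (radialGreen_pos hψ ht ha hr).ne'
  simp only [max_eq_right hs.2]
  field_simp

/-- Splitting at `r`, with F = ψ^(n-1) f^q, gives m f(r) = G(r) ∫_0^r F + ∫_r^∞ F G. On
differentiating, the two terms F G cancel and only G'(r) ∫_0^r F survives, where G' = -ψ^(1-n). -/
theorem IsModelFunction.hasDerivAt_of_green (hψ : IsModelFunction ψ) (ht : HasTailBound n ψ a)
    (ha : 1 < a) (hq : 0 < q) (hm : 0 < m) (hf : ContinuousOn f (Ioi 0))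
    (hint : ∀ r, 0 < r → IntegrableOn
      (fun s => ψ s ^ (n - 1) * (f s ^ q * radialGreen n ψ (max s r))) (Ioi 0))
    (heq : ∀ r, 0 < r →
      ∫ s in Ioi 0, ψ s ^ (n - 1) * (f s ^ q * radialGreen n ψ (max s r)) = m * f r)
    {r : ℝ} (hr : 0 < r) :
    HasDerivAt f (-((∫ s in 0..r, ψ s ^ (n - 1) * f s ^ q) / (m * ψ r ^ (n - 1)))) r := by
  set F : ℝ → ℝ := fun s => ψ s ^ (n - 1) * f s ^ q with hF
  have hFc : ContinuousOn F (Ioi 0) :=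
    hψ.continuousOn_pow.mul (hf.rpow_const fun _ _ => Or.inr hq.le)
  have hFi : ∀ r, 0 < r → IntervalIntegrable F volume 0 r := fun r hr =>
    hψ.intervalIntegrable_of_green ht ha hint hr
  have hG : ∀ r, 0 < r → HasDerivAt (radialGreen n ψ) (-(ψ r ^ (n - 1))⁻¹) r := fun r hr =>
    hasDerivAt_integral_Ioi hψ.continuousOn_inv_pow
      (fun r hr => integrableOn_Ioi_inv_pow hψ ht ha hr) hr
  have hGc : ContinuousOn (radialGreen n ψ) (Ioi 0) := fun r hr =>
    (hG r hr).continuousAt.continuousWithinAt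
  have hFG : ∀ r, 0 < r → IntegrableOn (fun s => F s * radialGreen n ψ s) (Ioi r) :=
    fun r hr => ((hint r hr).mono_set (Ioi_subset_Ioi hr.le)).congr_fun (fun s hs => by
      simp only [hF, max_eq_left (le_of_lt (mem_Ioi.1 hs)), mul_assoc]) measurableSet_Ioi
  have hrep : ∀ r, 0 < r → m⁻¹ * (radialGreen n ψ r * (∫ s in 0..r, F s) +
      ∫ s in Ioi r, F s * radialGreen n ψ s) = f r := fun r hr => by
    rw [inv_mul_eq_iff_eq_mul₀ hm.ne', ← heq r hr, ← Ioc_union_Ioi_eq_Ioi hr.le,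
      setIntegral_union (Ioc_disjoint_Ioi le_rfl) measurableSet_Ioi
        ((hint r hr).mono_set Ioc_subset_Ioi_self)
        ((hint r hr).mono_set (Ioi_subset_Ioi hr.le)),
      intervalIntegral.integral_of_le hr.le, ← integral_const_mul]
    congr 1
    · refine setIntegral_congr_fun measurableSet_Ioc fun s hs => ?_
      simp only [hF, max_eq_right hs.2]
      ring
    · refine setIntegral_congr_fun measurableSet_Ioi fun s hs => ?_
      simp only [hF, max_eq_left (le_of_lt (mem_Ioi.1 hs)), mul_assoc]
  have hd := (((hG r hr).mul (hasDerivAt_integral_zero hFc hFi hr)).add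
    (hasDerivAt_integral_Ioi (hFc.mul hGc) hFG hr)).const_mul m⁻¹
  have hw := (hψ.pow_pos (n := n) hr).ne'
  refine (hd.congr_of_eventuallyEq ?_).congr_deriv ?_
  · filter_upwards [Ioi_mem_nhds hr] with x hx using (hrep x hx).symm
  · simp only [Pi.mul_apply]
    field_simp
    ring

/-- By monotonicity `f` is positive on an initial interval, and the strictly positive kernel spreads
this to every `r`: a strong maximum principle. -/
theorem IsModelFunction.pos_of_green (hψ : IsModelFunction ψ) (ht : HasTailBound n ψ a)
    (ha : 1 < a) (hm : 0 < m) (hf0 : ∀ r, 0 < r → 0 ≤ f r)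
    (hanti : AntitoneOn f (Ioi 0)) (hne : ∃ r, 0 < r ∧ f r ≠ 0)
    (hint : ∀ r, 0 < r → IntegrableOn
      (fun s => ψ s ^ (n - 1) * (f s ^ q * radialGreen n ψ (max s r))) (Ioi 0))
    (heq : ∀ r, 0 < r →
      ∫ s in Ioi 0, ψ s ^ (n - 1) * (f s ^ q * radialGreen n ψ (max s r)) = m * f r)
    {r : ℝ} (hr : 0 < r) : 0 < f r := by
  obtain ⟨r₁, hr₁, hne⟩ := hne
  have hpos : ∀ s ∈ Ioc 0 r₁, 0 < f s := fun s hs =>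
    ((hf0 r₁ hr₁).lt_of_ne' hne).trans_le (hanti hs.1 hr₁ hs.2)
  refine pos_of_mul_pos_right ?_ hm.le
  rw [← heq r hr]
  refine (setIntegral_pos_iff_support_of_nonneg_ae
    (ae_restrict_of_forall_mem measurableSet_Ioi fun s hs => ?_) (hint r hr)).2 ?_
  · exact mul_nonneg (hψ.pow_pos hs).le (mul_nonneg (Real.rpow_nonneg (hf0 s hs) _)
      (radialGreen_nonneg hψ (hr.le.trans (le_max_right _ _))))
  · have : Ioc 0 r₁ ⊆ Function.support (fun s => ψ s ^ (n - 1) *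
        (f s ^ q * radialGreen n ψ (max s r))) ∩ Ioi 0 := fun s hs =>
      ⟨(mul_pos (hψ.pow_pos hs.1) (mul_pos (Real.rpow_pos_of_pos (hpos s hs) _)
        (radialGreen_pos hψ ht ha (lt_max_of_lt_right hr)))).ne', hs.1⟩
    refine lt_of_lt_of_le ?_ (measure_mono this)
    simpa using hr₁

end GreenRepresentation

/-! ### Boundedness at the pole -/

section Bootstrap

variable {n : ℕ} {ψ u : ℝ → ℝ} {q r₀ : ℝ}

/-- The radial Lane-Emden equation `(ψ ^ (n - 1) u')' = - ψ ^ (n - 1) u ^ q` on `(0, ∞)`, with no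
flux at the origin, in integrated form. -/
structure IsRadialSolution (n : ℕ) (ψ : ℝ → ℝ) (q : ℝ) (u : ℝ → ℝ) : Prop where
  pos : ∀ r, 0 < r → 0 < u r
  intervalIntegrable :
    ∀ r, 0 < r → IntervalIntegrable (fun s => ψ s ^ (n - 1) * u s ^ q) volume 0 r
  hasDerivAt : ∀ r, 0 < r →
    HasDerivAt u (-((∫ s in 0..r, ψ s ^ (n - 1) * u s ^ q) / ψ r ^ (n - 1))) r

theorem IsRadialSolution.continuousOn (hu : IsRadialSolution n ψ q u) : ContinuousOn u (Ioi 0) :=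
  fun r hr => (hu.hasDerivAt r hr).continuousAt.continuousWithinAt

/-- Power counting with ψ comparable to r: s^(n-1-βq) integrates to r^(n-βq), and division by
r^(n-1) leaves r^(1-βq). -/
theorem IsRadialSolution.integral_div_le (hu : IsRadialSolution n ψ q u) (hn : 2 ≤ n) (hq : 0 < q)
    (hψ : IsModelFunction ψ) (hb : ∀ r, 0 < r → r ≤ r₀ → r / 2 ≤ ψ r ∧ ψ r ≤ 2 * r)
    {C β : ℝ} (hβ : β * q < n) (hC : ∀ r, 0 < r → r ≤ r₀ → u r ≤ C * r ^ (-β)) :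
    ∃ K, 0 ≤ K ∧ ∀ r, 0 < r → r ≤ r₀ →
      (∫ s in 0..r, ψ s ^ (n - 1) * u s ^ q) / ψ r ^ (n - 1) ≤ K * r ^ (1 - β * q) := by
  rcases le_or_gt r₀ 0 with hr₀ | hr₀
  · exact ⟨0, le_rfl, fun r hr hr' => absurd (hr'.trans hr₀) (not_le.2 hr)⟩
  have hC0 : 0 ≤ C := by
    have h1 := (hu.pos r₀ hr₀).trans_le (hC r₀ hr₀ le_rfl)
    exact (pos_of_mul_pos_left h1 (Real.rpow_nonneg hr₀.le _)).le
  have hcast : ((n - 1 : ℕ) : ℝ) = (n : ℝ) - 1 := by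
    rw [Nat.cast_sub (by omega)]; simp
  have hnq : 0 < n - β * q := by linarith
  refine ⟨2 ^ (n - 1) * C ^ q * (n - β * q)⁻¹ * 2 ^ (n - 1), by positivity, fun r hr hrr => ?_⟩
  have h1 : ∫ s in 0..r, ψ s ^ (n - 1) * u s ^ q ≤
      ∫ s in 0..r, 2 ^ (n - 1) * C ^ q * s ^ ((n : ℝ) - β * q - 1) := by
    refine intervalIntegral.integral_mono_on_of_le_Ioo hr.le (hu.intervalIntegrable r hr)
      ((intervalIntegral.intervalIntegrable_rpow' (by linarith)).const_mul _) fun s hs => ?_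
    have hs0 := hs.1
    have hs1 : s ≤ r₀ := hs.2.le.trans hrr
    calc ψ s ^ (n - 1) * u s ^ q ≤ (2 * s) ^ (n - 1) * (C * s ^ (-β)) ^ q := by
          have := hψ.pos s hs0
          have := (hu.pos s hs0).le
          gcongr
          · exact (hb s hs0 hs1).2
          · exact hC s hs0 hs1
      _ = 2 ^ (n - 1) * C ^ q * s ^ ((n : ℝ) - β * q - 1) := by
          rw [mul_pow, Real.mul_rpow hC0 (by positivity), ← Real.rpow_mul hs0.le,
            show (n : ℝ) - β * q - 1 = ((n : ℝ) - 1) + -β * q by ring, Real.rpow_add hs0,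
            ← hcast, Real.rpow_natCast]
          ring
  rw [intervalIntegral.integral_const_mul, integral_rpow (Or.inl (by linarith)),
    sub_add_cancel, Real.zero_rpow hnq.ne', sub_zero] at h1
  rw [div_le_iff₀ (hψ.pow_pos hr)]
  refine h1.trans ?_
  have h2 : r ^ (n - 1) ≤ 2 ^ (n - 1) * ψ r ^ (n - 1) := by
    rw [← mul_pow]
    exact pow_le_pow_left₀ hr.le (by linarith [(hb r hr hrr).1]) _
  calc 2 ^ (n - 1) * C ^ q * (r ^ ((n : ℝ) - β * q) / (n - β * q))
      = 2 ^ (n - 1) * C ^ q * (n - β * q)⁻¹ * r ^ (1 - β * q) * r ^ (n - 1) := by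
        rw [show (n : ℝ) - β * q = (1 - β * q) + ((n : ℝ) - 1) by ring, Real.rpow_add hr,
          ← hcast, Real.rpow_natCast]
        ring
    _ ≤ 2 ^ (n - 1) * C ^ q * (n - β * q)⁻¹ * r ^ (1 - β * q) *
          (2 ^ (n - 1) * ψ r ^ (n - 1)) := by gcongr
    _ = _ := by ring

/-- One bootstrap step: -u' ≲ r^(1-βq) ≤ r^(-β'-1), integrated from `r` to `r₀` by comparison with a
power. Requiring β' > 0 keeps logarithms out. -/
theorem IsRadialSolution.le_rpow_of_le_rpow (hu : IsRadialSolution n ψ q u) (hn : 2 ≤ n)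
    (hq : 0 < q) (hψ : IsModelFunction ψ) (hr₀ : 0 < r₀) (hr₀1 : r₀ ≤ 1)
    (hb : ∀ r, 0 < r → r ≤ r₀ → r / 2 ≤ ψ r ∧ ψ r ≤ 2 * r) {C β β' : ℝ} (hβ : β * q < n)
    (hC : ∀ r, 0 < r → r ≤ r₀ → u r ≤ C * r ^ (-β)) (hβ' : 0 < β') (hββ' : β * q - 2 ≤ β') :
    ∃ C', ∀ r, 0 < r → r ≤ r₀ → u r ≤ C' * r ^ (-β') := by
  obtain ⟨K, hK, hKb⟩ := hu.integral_div_le hn hq hψ hb hβ hC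
  -- The first summand controls the derivative, the second the value at `r₀`.
  set C' := K / β' + u r₀ with hC'
  have hu0 := hu.pos r₀ hr₀
  have hC'0 : 0 ≤ C' := by positivity
  refine ⟨C', fun r hr hrr => ?_⟩
  have hd : ∀ s, 0 < s → HasDerivAt (fun s => C' * s ^ (-β') - u s)
      (C' * (-β' * s ^ (-β' - 1)) -
        -((∫ t in 0..s, ψ t ^ (n - 1) * u t ^ q) / ψ s ^ (n - 1))) s := fun s hs =>
    ((Real.hasDerivAt_rpow_const (Or.inl hs.ne')).const_mul C').sub (hu.hasDerivAt s hs)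
  have hanti : AntitoneOn (fun s => C' * s ^ (-β') - u s) (Ioc 0 r₀) := by
    refine antitoneOn_of_deriv_nonpos (convex_Ioc _ _)
      (fun s hs => (hd s hs.1).continuousAt.continuousWithinAt)
      (fun s hs => (hd s (interior_subset hs).1).differentiableAt.differentiableWithinAt)
      fun s hs => ?_
    have hs' := interior_subset hs
    rw [(hd s hs'.1).deriv]
    have h1 := hKb s hs'.1 hs'.2
    have h2 : s ^ (1 - β * q) ≤ s ^ (-β' - 1) :=
      Real.rpow_le_rpow_of_exponent_ge hs'.1 (hs'.2.trans hr₀1) (by linarith)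
    have h3 : K ≤ C' * β' := by
      rw [hC', add_mul, div_mul_cancel₀ _ hβ'.ne']
      nlinarith
    have h4 : 0 ≤ s ^ (-β' - 1) := Real.rpow_nonneg hs'.1.le _
    have h5 : K * s ^ (1 - β * q) ≤ C' * β' * s ^ (-β' - 1) :=
      mul_le_mul h3 h2 (Real.rpow_nonneg hs'.1.le _) (by positivity)
    nlinarith
  have h := hanti ⟨hr, hrr⟩ ⟨hr₀, le_rfl⟩ hrr
  have h6 : u r₀ ≤ C' * r₀ ^ (-β') := by
    have h7 : 1 ≤ r₀ ^ (-β') :=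
      Real.one_le_rpow_of_pos_of_le_one_of_nonpos hr₀ hr₀1 (by linarith)
    have h8 : u r₀ ≤ C' := by
      have : 0 ≤ K / β' := by positivity
      linarith
    nlinarith
  simp only at h
  linarith

/-- Once βq < 2, the bound r^(1-βq) on -u' is integrable at 0. -/
theorem IsRadialSolution.bounded_of_le_rpow (hu : IsRadialSolution n ψ q u) (hn : 2 ≤ n)
    (hq : 0 < q) (hψ : IsModelFunction ψ) (hr₀ : 0 < r₀)
    (hb : ∀ r, 0 < r → r ≤ r₀ → r / 2 ≤ ψ r ∧ ψ r ≤ 2 * r) {C β : ℝ} (hβ : β * q < 2)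
    (hC : ∀ r, 0 < r → r ≤ r₀ → u r ≤ C * r ^ (-β)) :
    ∃ C', ∀ r, 0 < r → r ≤ r₀ → u r ≤ C' := by
  have hn' : (2 : ℝ) ≤ n := by exact_mod_cast hn
  obtain ⟨K, hK, hKb⟩ := hu.integral_div_le hn hq hψ hb (hβ.trans_le hn') hC
  have hε : 0 < 2 - β * q := by linarith
  refine ⟨u r₀ + K / (2 - β * q) * r₀ ^ (2 - β * q), fun r hr hrr => ?_⟩
  have hd : ∀ s, 0 < s → HasDerivAt (fun s => u s + K / (2 - β * q) * s ^ (2 - β * q))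
      (-((∫ t in 0..s, ψ t ^ (n - 1) * u t ^ q) / ψ s ^ (n - 1)) +
        K / (2 - β * q) * ((2 - β * q) * s ^ (2 - β * q - 1))) s := fun s hs =>
    (hu.hasDerivAt s hs).add ((Real.hasDerivAt_rpow_const (Or.inl hs.ne')).const_mul _)
  have hmono : MonotoneOn (fun s => u s + K / (2 - β * q) * s ^ (2 - β * q)) (Ioc 0 r₀) := by
    refine monotoneOn_of_deriv_nonneg (convex_Ioc _ _)
      (fun s hs => (hd s hs.1).continuousAt.continuousWithinAt)
      (fun s hs => (hd s (interior_subset hs).1).differentiableAt.differentiableWithinAt)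
      fun s hs => ?_
    have hs' := interior_subset hs
    rw [(hd s hs'.1).deriv, ← mul_assoc, div_mul_cancel₀ _ hε.ne',
      show 2 - β * q - 1 = 1 - β * q by ring]
    linarith [hKb s hs'.1 hs'.2]
  have h := hmono ⟨hr, hrr⟩ ⟨hr₀, le_rfl⟩ hrr
  simp only at h
  have : 0 ≤ K / (2 - β * q) * r ^ (2 - β * q) := by positivity
  linarith

/-- A step sends an exponent b ≤ β to bq - 2 = b - (2 - b(q-1)) ≤ b - δ, so finitely many steps
reach the floor 1/q. The floor keeps exponents positive, and (1/q)q = 1 < 2 allows the concluding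
step. -/
theorem IsRadialSolution.bounded_near_zero (hu : IsRadialSolution n ψ q u) (hn : 2 ≤ n)
    (hq : 1 < q) (hψ : IsModelFunction ψ) (hr₀ : 0 < r₀) (hr₀1 : r₀ ≤ 1)
    (hb : ∀ r, 0 < r → r ≤ r₀ → r / 2 ≤ ψ r ∧ ψ r ≤ 2 * r) {C β : ℝ} (hβq : 1 / q < β)
    (hβn : β * (q + 1) < n) (hβ2 : β * (q - 1) < 2)
    (hC : ∀ r, 0 < r → r ≤ r₀ → u r ≤ C * r ^ (-β)) :
    ∃ C', ∀ r, 0 < r → r ≤ r₀ → u r ≤ C' := by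
  have hq0 : 0 < q := by linarith
  have hq1 : 0 < 1 / q := by positivity
  set δ := 2 - β * (q - 1) with hδ
  have hδ0 : 0 < δ := by linarith
  have key : ∀ k : ℕ, ∃ C', ∀ r, 0 < r → r ≤ r₀ →
      u r ≤ C' * r ^ (-(max (β - k * δ) (1 / q))) := by
    intro k
    induction k with
    | zero => exact ⟨C, by simpa [max_eq_left (one_div q ▸ hβq.le)] using hC⟩
    | succ k ih =>
      obtain ⟨C', hC'⟩ := ih
      have hle : max (β - k * δ) (1 / q) ≤ β := by
        have : 0 ≤ k * δ := by positivity
        exact max_le (by linarith) hβq.le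
      refine hu.le_rpow_of_le_rpow hn hq0 hψ hr₀ hr₀1 hb ?_ hC' (lt_max_of_lt_right hq1) ?_
      · nlinarith
      · rcases le_total (β - k * δ) (1 / q) with h | h
        · rw [max_eq_right h, one_div_mul_cancel hq0.ne']
          exact le_trans (by linarith) (le_max_right _ _)
        · rw [max_eq_left h]
          refine le_trans ?_ (le_max_left _ _)
          push_cast
          have : 0 ≤ k * δ * (q - 1) := by
            have : 0 < q - 1 := by linarith
            positivity
          nlinarith
  obtain ⟨k, hk⟩ := exists_nat_gt (β / δ)
  rw [div_lt_iff₀ hδ0] at hk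
  obtain ⟨C', hC'⟩ := key k
  rw [max_eq_right (by linarith)] at hC'
  exact hu.bounded_of_le_rpow hn hq0 hψ hr₀ hb (by rw [one_div_mul_cancel hq0.ne']; norm_num) hC'

end Bootstrap

/-! ### Smoothness of radial functions across the pole -/

section RadialCalculus

open scoped RealInnerProductSpace

theorem tendsto_comp_norm_nhds_zero {E : Type*} [NormedAddCommGroup E] {v : ℝ → ℝ}
    (h0 : Tendsto v (𝓝[>] 0) (𝓝 (v 0))) :
    Tendsto (fun y : E => v ‖y‖) (𝓝 0) (𝓝 (v 0)) := by
  have h1 : Tendsto v (𝓝[≥] 0) (𝓝 (v 0)) :=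
    (continuousWithinAt_Ioi_iff_Ici.1 h0 : ContinuousWithinAt v (Ici 0) 0)
  refine h1.comp (tendsto_nhdsWithin_iff.2 ⟨?_, Eventually.of_forall fun y => norm_nonneg y⟩)
  exact tendsto_norm_zero

variable {E : Type*} [NormedAddCommGroup E] [InnerProductSpace ℝ E] {v v' : ℝ → ℝ}

theorem hasFDerivAt_norm_of_ne_zero {x : E} (hx : x ≠ 0) :
    HasFDerivAt (fun y : E => ‖y‖) (‖x‖⁻¹ • innerSL ℝ x) x := by
  have hx' : ‖x‖ ≠ 0 := norm_ne_zero_iff.2 hx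
  have h := (hasStrictFDerivAt_norm_sq x).hasFDerivAt.sqrt (by positivity)
  simp only [Real.sqrt_sq (norm_nonneg _)] at h
  convert! h using 1
  ext y
  simp
  field_simp

theorem hasFDerivAt_comp_norm {x : E} (hx : x ≠ 0) {c : ℝ} (hv : HasDerivAt v c ‖x‖) :
    HasFDerivAt (fun y : E => v ‖y‖) ((c * ‖x‖⁻¹) • innerSL ℝ x) x := by
  rw [mul_smul]
  exact hv.comp_hasFDerivAt x (hasFDerivAt_norm_of_ne_zero hx)

theorem hasFDerivAt_norm_smul {x : E} (hx : x ≠ 0) {c : ℝ} (hv : HasDerivAt v c ‖x‖) :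
    HasFDerivAt (fun y : E => v ‖y‖ • y)
      (v ‖x‖ • ContinuousLinearMap.id ℝ E +
        ((c * ‖x‖⁻¹) • innerSL ℝ x).smulRight x) x :=
  (hasFDerivAt_comp_norm hx hv).smul (hasFDerivAt_id x)

/-- Continuity of `v` at 0 suffices, because (v(‖y‖) - v(0)) y = o(‖y‖). -/
theorem hasFDerivAt_norm_smul_zero (h0 : Tendsto v (𝓝[>] 0) (𝓝 (v 0))) :
    HasFDerivAt (fun y : E => v ‖y‖ • y) (v 0 • ContinuousLinearMap.id ℝ E) 0 := by
  rw [hasFDerivAt_iff_isLittleO_nhds_zero]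
  have h1 : Tendsto (fun y : E => v ‖y‖ - v 0) (𝓝 0) (𝓝 0) := by
    simpa using (tendsto_comp_norm_nhds_zero (E := E) h0).sub_const (v 0)
  have h2 := ((Asymptotics.isLittleO_one_iff ℝ).2 h1).smul_isBigO
    (Asymptotics.isBigO_refl (fun y : E => y) (𝓝 0))
  simpa [sub_smul] using h2

/-- The derivative v Id + (v'/r) x ⊗ x extends continuously to 0: its second term has norm r
|v'(r)|, which tends to 0. -/
theorem contDiff_one_norm_smul (hv : ∀ r, 0 < r → HasDerivAt v (v' r) r)
    (hc : ContinuousOn v' (Ioi 0)) (h0 : Tendsto v (𝓝[>] 0) (𝓝 (v 0)))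
    (hz : Tendsto (fun r => r * v' r) (𝓝[>] 0) (𝓝 0)) :
    ContDiff ℝ 1 (fun y : E => v ‖y‖ • y) := by
  rw [contDiff_one_iff_hasFDerivAt]
  refine ⟨fun x => v ‖x‖ • ContinuousLinearMap.id ℝ E +
    ((v' ‖x‖ * ‖x‖⁻¹) • innerSL ℝ x).smulRight x, ?_, fun x => ?_⟩
  · rw [continuous_iff_continuousAt]
    intro x
    rcases eq_or_ne x 0 with rfl | hx
    · have h1 := (tendsto_comp_norm_nhds_zero (E := E) h0).smul_const
        (ContinuousLinearMap.id ℝ E)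
      have h2 : Tendsto (fun x : E => ((v' ‖x‖ * ‖x‖⁻¹) • innerSL ℝ x).smulRight x) (𝓝 0)
          (𝓝 0) := by
        have h3 : Tendsto (fun y : E => |(fun r => r * v' r) ‖y‖|) (𝓝 0) (𝓝 0) := by
          have := (tendsto_comp_norm_nhds_zero (E := E) (v := fun r => r * v' r)
            (by simpa using hz)).abs
          simpa using this
        refine squeeze_zero_norm (fun y => ?_) h3
        rw [ContinuousLinearMap.norm_smulRight_apply, norm_smul, innerSL_apply_norm, norm_mul,
          norm_inv, norm_norm, abs_mul, abs_norm, Real.norm_eq_abs]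
        rcases eq_or_ne y 0 with rfl | hy
        · simp
        · have : ‖y‖ ≠ 0 := norm_ne_zero_iff.2 hy
          apply le_of_eq
          field_simp
      simpa [ContinuousAt] using h1.add h2
    · have hx' : 0 < ‖x‖ := norm_pos_iff.2 hx
      have h1 : ContinuousAt (fun y : E => v ‖y‖) x :=
        (hasFDerivAt_comp_norm hx (hv _ hx')).continuousAt
      have h2 : ContinuousAt (fun y : E => v' ‖y‖) x :=
        ContinuousAt.comp (f := fun y : E => ‖y‖) (hc.continuousAt (Ioi_mem_nhds hx'))
          continuous_norm.continuousAt
      have h3 : ContinuousAt (fun y : E => ‖y‖⁻¹) x :=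
        continuous_norm.continuousAt.inv₀ hx'.ne'
      have h4 : ContinuousAt (fun y : E => (v' ‖y‖ * ‖y‖⁻¹) • innerSL ℝ y) x :=
        (h2.mul h3).smul (innerSL ℝ).continuous.continuousAt
      have h5 : ContinuousAt (fun y : E =>
          ContinuousLinearMap.smulRightL ℝ E E ((v' ‖y‖ * ‖y‖⁻¹) • innerSL ℝ y) y) x :=
        ((ContinuousLinearMap.smulRightL ℝ E E).continuous.continuousAt.comp h4).clm_apply
          continuousAt_id
      exact (h1.smul continuousAt_const).add h5
  · rcases eq_or_ne x 0 with rfl | hx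
    · convert! hasFDerivAt_norm_smul_zero (E := E) h0 using 1
      simp
    · exact hasFDerivAt_norm_smul hx (hv _ (norm_pos_iff.2 hx))

variable {u : ℝ → ℝ}

theorem hasFDerivAt_comp_norm_of_slope (hu : ∀ r, 0 < r → HasDerivAt u (v r * r) r)
    (hu0 : Tendsto (fun r => (u r - u 0) / r) (𝓝[>] 0) (𝓝 0)) (x : E) :
    HasFDerivAt (fun y : E => u ‖y‖) (innerSL ℝ (v ‖x‖ • x)) x := by
  rcases eq_or_ne x 0 with rfl | hx
  · rw [hasFDerivAt_iff_isLittleO_nhds_zero]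
    have h1 : Tendsto (fun y : E => (u ‖y‖ - u 0) / ‖y‖) (𝓝 0) (𝓝 0) := by
      have := tendsto_comp_norm_nhds_zero (E := E) (v := fun r => (u r - u 0) / r)
        (by simpa using hu0)
      simpa using this
    have h2 : (fun y : E => u ‖y‖ - u 0) =o[𝓝 0] fun y : E => ‖y‖ :=
      (Asymptotics.isLittleO_iff_tendsto fun y hy => by simp [hy]).2 h1
    simpa using h2.of_norm_right
  · have hx' : 0 < ‖x‖ := norm_pos_iff.2 hx
    convert! hasFDerivAt_comp_norm hx (hu _ hx') using 1
    rw [map_smul]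
    congr 1
    field_simp

/-- With v = u'/r the gradient is v(‖x‖) x, so the claim reduces to a C¹ statement about that field.
-/
theorem contDiff_two_comp_norm (hu : ∀ r, 0 < r → HasDerivAt u (v r * r) r)
    (hu0 : Tendsto (fun r => (u r - u 0) / r) (𝓝[>] 0) (𝓝 0))
    (hv : ∀ r, 0 < r → HasDerivAt v (v' r) r)
    (hc : ContinuousOn v' (Ioi 0)) (h0 : Tendsto v (𝓝[>] 0) (𝓝 (v 0)))
    (hz : Tendsto (fun r => r * v' r) (𝓝[>] 0) (𝓝 0)) :
    ContDiff ℝ 2 (fun y : E => u ‖y‖) := by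
  have h := contDiff_succ_iff_hasFDerivAt (𝕜 := ℝ) (f := fun y : E => u ‖y‖) (n := 1)
  rw [show ((1 : ℕ) : WithTop ℕ∞) + 1 = 2 by norm_num] at h
  refine h.2 ⟨fun x => innerSL ℝ (v ‖x‖ • x), ?_, hasFDerivAt_comp_norm_of_slope hu hu0⟩
  exact (innerSL ℝ (E := E)).contDiff.comp (contDiff_one_norm_smul hv hc h0 hz)

end RadialCalculus

/-! ### The Laplace-Beltrami operator on radial functions -/

section ModelMetric

variable {n : ℕ} {ψ : ℝ → ℝ}

theorem modelMetric_zero : modelMetric n ψ 0 = 1 := by simp [modelMetric]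

theorem dotProduct_self_eq_norm_sq (x : EuclideanSpace ℝ (Fin n)) :
    (fun i => x i) ⬝ᵥ (fun i => x i) = ‖x‖ ^ 2 := by
  rw [EuclideanSpace.norm_sq_eq]
  simp [dotProduct, sq]

/-- A rank-one perturbation of a multiple of the identity, the form in which the matrix determinant
lemma applies. -/
theorem modelMetric_eq_smul {x : EuclideanSpace ℝ (Fin n)} (hx : x ≠ 0) (hψ : 0 < ψ ‖x‖) :
    modelMetric n ψ x = ((ψ ‖x‖ / ‖x‖) ^ 2) • (1 + Matrix.replicateCol Unit
      (fun i => ((1 - (ψ ‖x‖ / ‖x‖) ^ 2) / ((ψ ‖x‖ / ‖x‖) ^ 2 * ‖x‖ ^ 2)) * x i) *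
        Matrix.replicateRow Unit (fun i => x i)) := by
  have hx' : 0 < ‖x‖ := norm_pos_iff.2 hx
  ext i j
  simp only [modelMetric, if_neg hx, Matrix.of_apply, Matrix.smul_apply, Matrix.add_apply,
    Matrix.one_apply, Matrix.mul_apply, Matrix.replicateCol_apply, Matrix.replicateRow_apply,
    Finset.univ_unique, Finset.sum_singleton, smul_eq_mul]
  split_ifs <;> field_simp <;> ring

theorem det_modelMetric (hn : 1 ≤ n) {x : EuclideanSpace ℝ (Fin n)} (hx : x ≠ 0)
    (hψ : 0 < ψ ‖x‖) : (modelMetric n ψ x).det = ((ψ ‖x‖ / ‖x‖) ^ (n - 1)) ^ 2 := by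
  have hx' : 0 < ‖x‖ := norm_pos_iff.2 hx
  obtain ⟨k, rfl⟩ := Nat.exists_eq_add_of_le' hn
  rw [modelMetric_eq_smul hx hψ, Matrix.det_smul, Matrix.det_one_add_replicateCol_mul_replicateRow,
    Fintype.card_fin, Nat.add_sub_cancel]
  have h1 : ∀ c : ℝ, (fun i => x i) ⬝ᵥ (fun i => c * x i) = c * ‖x‖ ^ 2 := fun c => by
    rw [← dotProduct_self_eq_norm_sq, ← smul_eq_mul, ← dotProduct_smul]
    rfl
  rw [h1, ← pow_mul, ← pow_mul (ψ ‖x‖ / ‖x‖) k 2, mul_comm k 2, mul_add 2 k 1, pow_add]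
  have ht : ψ ‖x‖ / ‖x‖ ≠ 0 := by positivity
  generalize ψ ‖x‖ / ‖x‖ = t at ht
  field_simp
  ring

theorem sqrt_det_modelMetric (hn : 1 ≤ n) {x : EuclideanSpace ℝ (Fin n)} (hx : x ≠ 0)
    (hψ : 0 < ψ ‖x‖) : √((modelMetric n ψ x).det) = (ψ ‖x‖ / ‖x‖) ^ (n - 1) := by
  rw [det_modelMetric hn hx hψ, Real.sqrt_sq (by positivity)]

/-- The radial direction has eigenvalue 1 for the metric, hence also for its inverse. -/
theorem sum_inv_modelMetric_mul (hn : 1 ≤ n) (x : EuclideanSpace ℝ (Fin n))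
    (hψ : ∀ r, 0 < r → 0 < ψ r) (i : Fin n) :
    ∑ j, (modelMetric n ψ x)⁻¹ i j * x j = x i := by
  rcases eq_or_ne x 0 with rfl | hx
  · simp
  have hx' : 0 < ‖x‖ := norm_pos_iff.2 hx
  have hψx := hψ _ hx'
  have hdet : IsUnit (modelMetric n ψ x).det := by
    rw [det_modelMetric hn hx hψx]
    exact (by positivity : ((ψ ‖x‖ / ‖x‖) ^ (n - 1)) ^ 2 ≠ 0).isUnit
  have hmul : (modelMetric n ψ x).mulVec (fun j => x j) = fun j => x j := by
    ext k
    have hsum : ∑ j, x j * x j = ‖x‖ ^ 2 := dotProduct_self_eq_norm_sq x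
    calc (modelMetric n ψ x).mulVec (fun j => x j) k
        = ∑ j, ((1 - (ψ ‖x‖ / ‖x‖) ^ 2) / ‖x‖ ^ 2 * x k * (x j * x j) +
            (ψ ‖x‖ / ‖x‖) ^ 2 * ((if k = j then 1 else 0) * x j)) := by
          simp only [Matrix.mulVec, dotProduct, modelMetric, if_neg hx, Matrix.of_apply]
          refine Finset.sum_congr rfl fun j _ => ?_
          ring
      _ = x k := by
          rw [Finset.sum_add_distrib, ← Finset.mul_sum, ← Finset.mul_sum, hsum]
          simp only [ite_mul, one_mul, zero_mul, Finset.sum_ite_eq, Finset.mem_univ, if_true]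
          field_simp
          ring
  have h := congrFun (congrArg ((modelMetric n ψ x)⁻¹).mulVec hmul) i
  rw [Matrix.mulVec_mulVec, Matrix.nonsing_inv_mul _ hdet, Matrix.one_mulVec] at h
  exact h.symm

theorem partialDeriv_of_hasFDerivAt {f : EuclideanSpace ℝ (Fin n) → ℝ}
    {x : EuclideanSpace ℝ (Fin n)} {L : EuclideanSpace ℝ (Fin n) →L[ℝ] ℝ}
    (h : HasFDerivAt f L x) (i : Fin n) : partialDeriv i f x = L (EuclideanSpace.single i 1) := by
  rw [partialDeriv, h.fderiv]

theorem sum_partialDeriv_of_hasFDerivAt {K : EuclideanSpace ℝ (Fin n) → EuclideanSpace ℝ (Fin n)}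
    {x : EuclideanSpace ℝ (Fin n)}
    {L : EuclideanSpace ℝ (Fin n) →L[ℝ] EuclideanSpace ℝ (Fin n)} (h : HasFDerivAt K L x) :
    ∑ i, partialDeriv i (fun y => K y i) x = ∑ i, L (EuclideanSpace.single i 1) i := by
  refine Finset.sum_congr rfl fun i _ => ?_
  exact partialDeriv_of_hasFDerivAt
    ((EuclideanSpace.proj (𝕜 := ℝ) i).hasFDerivAt.comp x h) i

/-- The Laplace-Beltrami operator of a radial function with gradient `v (r) x`. -/
theorem laplaceBeltrami_of_partialDeriv (hn : 1 ≤ n) (hψ : ∀ r, 0 < r → 0 < ψ r)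
    {U : EuclideanSpace ℝ (Fin n) → ℝ} {v M : ℝ → ℝ}
    (hU : ∀ x, HasFDerivAt U (innerSL ℝ (v ‖x‖ • x)) x)
    (hM : ∀ r, 0 < r → M r = (ψ r / r) ^ (n - 1) * v r)
    {x : EuclideanSpace ℝ (Fin n)}
    {L : EuclideanSpace ℝ (Fin n) →L[ℝ] EuclideanSpace ℝ (Fin n)}
    (hL : HasFDerivAt (fun y : EuclideanSpace ℝ (Fin n) => M ‖y‖ • y) L x) :
    laplaceBeltrami (modelMetric n ψ) U x =
      1 / √((modelMetric n ψ x).det) * ∑ i, L (EuclideanSpace.single i 1) i := by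
  have hpd : ∀ j y, partialDeriv j U y = v ‖y‖ * y j := fun j y => by
    rw [partialDeriv_of_hasFDerivAt (hU y), innerSL_apply_apply, real_inner_smul_left,
      EuclideanSpace.inner_single_right]
    simp
  rw [laplaceBeltrami, ← sum_partialDeriv_of_hasFDerivAt hL]
  congr 1
  -- The field under the divergence is M(‖y‖) y: the inverse metric fixes `y` and √det g =
  -- (ψ/r)^(n-1). At y = 0 both sides vanish.
  refine Finset.sum_congr rfl fun i _ => ?_
  congr 1
  ext y
  simp only [hpd, mul_left_comm _ (v ‖y‖), ← Finset.mul_sum, sum_inv_modelMetric_mul hn y hψ]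
  rcases eq_or_ne y 0 with rfl | hy
  · simp
  · have hy' : 0 < ‖y‖ := norm_pos_iff.2 hy
    rw [sqrt_det_modelMetric hn hy (hψ _ hy'), PiLp.smul_apply, smul_eq_mul, hM _ hy']
    ring

theorem laplaceBeltrami_radial_zero (hn : 1 ≤ n) (hψ : ∀ r, 0 < r → 0 < ψ r)
    {U : EuclideanSpace ℝ (Fin n) → ℝ} {v M : ℝ → ℝ}
    (hU : ∀ x, HasFDerivAt U (innerSL ℝ (v ‖x‖ • x)) x)
    (hM : ∀ r, 0 < r → M r = (ψ r / r) ^ (n - 1) * v r)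
    (hM0 : Tendsto M (𝓝[>] 0) (𝓝 (M 0))) :
    laplaceBeltrami (modelMetric n ψ) U 0 = n * M 0 := by
  rw [laplaceBeltrami_of_partialDeriv hn hψ hU hM (hasFDerivAt_norm_smul_zero hM0),
    modelMetric_zero]
  simp

theorem laplaceBeltrami_radial_of_ne_zero (hn : 1 ≤ n) (hψ : ∀ r, 0 < r → 0 < ψ r)
    {U : EuclideanSpace ℝ (Fin n) → ℝ} {v M : ℝ → ℝ}
    (hU : ∀ x, HasFDerivAt U (innerSL ℝ (v ‖x‖ • x)) x)
    (hM : ∀ r, 0 < r → M r = (ψ r / r) ^ (n - 1) * v r)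
    {x : EuclideanSpace ℝ (Fin n)} (hx : x ≠ 0) {c : ℝ} (hc : HasDerivAt M c ‖x‖) :
    laplaceBeltrami (modelMetric n ψ) U x =
      (n * M ‖x‖ + c * ‖x‖) / (ψ ‖x‖ / ‖x‖) ^ (n - 1) := by
  have hx' : 0 < ‖x‖ := norm_pos_iff.2 hx
  rw [laplaceBeltrami_of_partialDeriv hn hψ hU hM (hasFDerivAt_norm_smul hx hc),
    sqrt_det_modelMetric hn hx (hψ _ hx'), one_div, mul_comm, ← div_eq_mul_inv]
  congr 1
  have hsum : ∑ j, x j * x j = ‖x‖ ^ 2 := dotProduct_self_eq_norm_sq x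
  have h1 : ∀ i, (M ‖x‖ • ContinuousLinearMap.id ℝ (EuclideanSpace ℝ (Fin n)) +
      ((c * ‖x‖⁻¹) • innerSL ℝ x).smulRight x) (EuclideanSpace.single i 1) i =
      M ‖x‖ + c * ‖x‖⁻¹ * (x i * x i) := fun i => by
    simp [EuclideanSpace.inner_single_right]
    ring
  rw [Finset.sum_congr rfl fun i _ => h1 i, Finset.sum_add_distrib, ← Finset.mul_sum, hsum]
  simp only [Finset.sum_const, Finset.card_univ, Fintype.card_fin, nsmul_eq_mul]
  field_simp

end ModelMetric

/-! ### From the radial equation to a classical solution -/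

section LaneEmden

variable {n : ℕ} {ψ u : ℝ → ℝ} {q : ℝ}

theorem IsModelFunction.hasDerivAt_pow (hψ : IsModelFunction ψ) {r : ℝ} (hr : 0 < r) :
    HasDerivAt (fun r => ψ r ^ (n - 1))
      (ψ r ^ (n - 1) * ((n - 1 : ℕ) * (deriv ψ r / ψ r))) r := by
  refine ((hψ.hasDerivAt hr).pow (n - 1)).congr_deriv ?_
  have := (hψ.pos r hr).ne'
  rcases Nat.eq_zero_or_pos (n - 1) with h | h
  · simp [h]
  · obtain ⟨k, hk⟩ := Nat.exists_eq_add_of_le' h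
    rw [hk, Nat.add_sub_cancel, pow_succ]
    field_simp

theorem IsModelFunction.continuousOn_deriv (hψ : IsModelFunction ψ) :
    ContinuousOn (deriv ψ) (Ioi 0) :=
  (hψ.smooth.mono Ioi_subset_Ici_self).continuousOn_deriv_of_isOpen isOpen_Ioi (by simp)

/-- `∫_0^r ψ ^ (n - 1) u ^ q`. -/
noncomputable def radialFlux (n : ℕ) (ψ : ℝ → ℝ) (q : ℝ) (u : ℝ → ℝ) (r : ℝ) : ℝ :=
  ∫ s in 0..r, ψ s ^ (n - 1) * u s ^ q

theorem IsRadialSolution.hasDerivAt_radialFlux (hu : IsRadialSolution n ψ q u)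
    (hψ : IsModelFunction ψ) (hq : 0 < q) {r : ℝ} (hr : 0 < r) :
    HasDerivAt (radialFlux n ψ q u) (ψ r ^ (n - 1) * u r ^ q) r :=
  hasDerivAt_integral_zero
    (hψ.continuousOn_pow.mul (hu.continuousOn.rpow_const fun _ _ => Or.inr hq.le))
    hu.intervalIntegrable hr

theorem IsRadialSolution.tendsto_radialFlux (hu : IsRadialSolution n ψ q u) :
    Tendsto (radialFlux n ψ q u) (𝓝[>] 0) (𝓝 0) := by
  have h1 : IntegrableOn (fun s => ψ s ^ (n - 1) * u s ^ q) (uIcc 0 1) := by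
    rw [uIcc_of_le zero_le_one, integrableOn_Icc_iff_integrableOn_Ioc,
      ← intervalIntegrable_iff_integrableOn_Ioc_of_le zero_le_one]
    exact hu.intervalIntegrable 1 one_pos
  have h2 := intervalIntegral.continuousOn_primitive_interval h1 0 left_mem_uIcc
  have h3 : Tendsto (radialFlux n ψ q u) (𝓝[uIcc 0 1] 0) (𝓝 0) := by
    change Tendsto (fun x => ∫ t in 0..x, ψ t ^ (n - 1) * u t ^ q) _ _
    simpa [ContinuousWithinAt] using h2
  refine h3.mono_left ?_
  rw [uIcc_of_le zero_le_one, ← nhdsWithin_Ioc_eq_nhdsGT one_pos]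
  exact nhdsWithin_mono _ Ioc_subset_Icc_self

/-- L'Hôpital: the quotient of derivatives is (ψ/r)^(n-1) u^q / n. -/
theorem IsRadialSolution.tendsto_radialFlux_div_pow (hu : IsRadialSolution n ψ q u)
    (hψ : IsModelFunction ψ) (hn : 2 ≤ n) (hq : 0 < q)
    (hlim : Tendsto u (𝓝[>] 0) (𝓝 (u 0))) :
    Tendsto (fun r => radialFlux n ψ q u r / r ^ n) (𝓝[>] 0) (𝓝 (u 0 ^ q / n)) := by
  have hn0 : (n : ℝ) ≠ 0 := by
    have : n ≠ 0 := by omega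
    exact_mod_cast this
  refine HasDerivAt.lhopital_zero_nhdsGT
    (f' := fun r => ψ r ^ (n - 1) * u r ^ q) (g' := fun r => n * r ^ (n - 1)) ?_ ?_ ?_
    hu.tendsto_radialFlux ?_ ?_
  · filter_upwards [self_mem_nhdsWithin] with r hr using hu.hasDerivAt_radialFlux hψ hq hr
  · exact Eventually.of_forall fun r => hasDerivAt_pow n r
  · filter_upwards [self_mem_nhdsWithin] with r hr
    exact mul_ne_zero hn0 (pow_ne_zero _ (ne_of_gt hr))
  · have : Tendsto (fun r : ℝ => r ^ n) (𝓝 0) (𝓝 0) := by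
      have h := (continuous_pow n).tendsto (0 : ℝ)
      rwa [zero_pow (by omega)] at h
    exact this.mono_left nhdsWithin_le_nhds
  · have h := ((hψ.tendsto_div_nhdsGT.pow (n - 1)).mul
      (hlim.rpow_const (Or.inr hq.le) : Tendsto (fun r => u r ^ q) _ _)).div_const (n : ℝ)
    rw [one_pow, one_mul] at h
    refine h.congr' ?_
    filter_upwards [self_mem_nhdsWithin] with r hr
    have : r ≠ 0 := ne_of_gt hr
    rw [div_pow]
    field_simp

theorem IsRadialSolution.tendsto_radialFlux_div (hu : IsRadialSolution n ψ q u)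
    (hψ : IsModelFunction ψ) (hn : 2 ≤ n) (hq : 0 < q)
    (hlim : Tendsto u (𝓝[>] 0) (𝓝 (u 0))) :
    Tendsto (fun r => radialFlux n ψ q u r / (r * ψ r ^ (n - 1))) (𝓝[>] 0)
      (𝓝 (u 0 ^ q / n)) := by
  have h := (hu.tendsto_radialFlux_div_pow hψ hn hq hlim).div
    (hψ.tendsto_div_nhdsGT.pow (n - 1)) (by simp)
  rw [one_pow, div_one] at h
  refine h.congr' ?_
  filter_upwards [self_mem_nhdsWithin] with r hr
  have : r ≠ 0 := ne_of_gt hr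
  have := (hψ.pow_pos (n := n) hr).ne'
  obtain ⟨k, rfl⟩ : ∃ k, n = k + 1 := ⟨n - 1, by omega⟩
  simp only [Nat.add_sub_cancel] at *
  rw [Pi.div_apply, div_pow, pow_succ]
  field_simp

theorem IsRadialSolution.tendsto_slope_zero (hu : IsRadialSolution n ψ q u)
    (hψ : IsModelFunction ψ) (hn : 2 ≤ n) (hq : 0 < q)
    (hlim : Tendsto u (𝓝[>] 0) (𝓝 (u 0))) :
    Tendsto (fun r => (u r - u 0) / r) (𝓝[>] 0) (𝓝 0) := by
  have hid : Tendsto (fun r : ℝ => r) (𝓝[>] 0) (𝓝 0) := nhdsWithin_le_nhds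
  refine HasDerivAt.lhopital_zero_nhdsGT
    (f' := fun r => -(radialFlux n ψ q u r / ψ r ^ (n - 1))) (g' := fun _ => 1) ?_
    (Eventually.of_forall fun r => hasDerivAt_id r) (Eventually.of_forall fun _ => one_ne_zero)
    ?_ hid ?_
  · filter_upwards [self_mem_nhdsWithin] with r hr using (hu.hasDerivAt r hr).sub_const _
  · simpa using hlim.sub_const (u 0)
  · have h := ((hu.tendsto_radialFlux_div hψ hn hq hlim).mul hid).neg
    rw [mul_zero, neg_zero] at h
    refine h.congr' ?_
    filter_upwards [self_mem_nhdsWithin] with r hr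
    have : r ≠ 0 := ne_of_gt hr
    have := (hψ.pow_pos (n := n) hr).ne'
    field_simp

/-- With A the flux, the gradient factor is v = -A/(r ψ^(n-1)) and the divergence is taken of M(r) x
with M = -A/r^n. Then n M + r M' = -A'/r^(n-1), and dividing by (ψ/r)^(n-1) leaves -u^q. At the pole
n M(0) = -u(0)^q. -/
theorem IsRadialSolution.isLaneEmdenSolution (hu : IsRadialSolution n ψ q u)
    (hψ : IsModelFunction ψ) (hn : 2 ≤ n) (hq : 0 < q)
    (hlim : Tendsto u (𝓝[>] 0) (𝓝 (u 0))) (hu0 : 0 < u 0) :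
    IsLaneEmdenSolution n ψ q (radial n u) := by
  have hn0 : (n : ℝ) ≠ 0 := by
    have : n ≠ 0 := by omega
    exact_mod_cast this
  set A := radialFlux n ψ q u with hA
  -- The values of `v` and `M` at 0 are their limits, so that both fields extend across the pole.
  set v : ℝ → ℝ := fun r => if 0 < r then -(A r / (r * ψ r ^ (n - 1))) else -(u 0 ^ q / n) with hv
  set M : ℝ → ℝ := fun r => if 0 < r then -(A r / r ^ n) else -(u 0 ^ q / n) with hM
  set v' : ℝ → ℝ := fun r => -(u r ^ q / r - A r / (r * ψ r ^ (n - 1)) *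
    (1 / r + (n - 1 : ℕ) * (deriv ψ r / ψ r))) with hv'
  have hAd : ∀ r, 0 < r → HasDerivAt A (ψ r ^ (n - 1) * u r ^ q) r := fun r hr =>
    hu.hasDerivAt_radialFlux hψ hq hr
  have hv0 : Tendsto v (𝓝[>] 0) (𝓝 (v 0)) := by
    have h := (hu.tendsto_radialFlux_div hψ hn hq hlim).neg
    rw [show v 0 = -(u 0 ^ q / n) by simp [hv]]
    refine h.congr' ?_
    filter_upwards [self_mem_nhdsWithin] with r hr
    simp only [hv, if_pos (mem_Ioi.1 hr), hA]
  have hM0 : Tendsto M (𝓝[>] 0) (𝓝 (M 0)) := by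
    have h := (hu.tendsto_radialFlux_div_pow hψ hn hq hlim).neg
    rw [show M 0 = -(u 0 ^ q / n) by simp [hM]]
    refine h.congr' ?_
    filter_upwards [self_mem_nhdsWithin] with r hr
    simp only [hM, if_pos (mem_Ioi.1 hr), hA]
  have hud : ∀ r, 0 < r → HasDerivAt u (v r * r) r := fun r hr => by
    refine (hu.hasDerivAt r hr).congr_deriv ?_
    have := (hψ.pow_pos (n := n) hr).ne'
    simp only [hv, if_pos hr, hA, radialFlux]
    field_simp
  have hvd : ∀ r, 0 < r → HasDerivAt v (v' r) r := fun r hr => by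
    have hw := (hψ.pow_pos (n := n) hr).ne'
    have h := ((hAd r hr).div ((hasDerivAt_id r).mul (hψ.hasDerivAt_pow (n := n) hr))
      (mul_ne_zero hr.ne' hw)).neg
    have hψr := (hψ.pos r hr).ne'
    refine (h.congr_of_eventuallyEq ?_).congr_deriv ?_
    · filter_upwards [Ioi_mem_nhds hr] with s hs
      simp only [hv, if_pos (mem_Ioi.1 hs)]
      rfl
    · simp only [hv', id, Pi.mul_apply]
      field_simp
  have hMd : ∀ r, 0 < r → HasDerivAt M
      (-((ψ r ^ (n - 1) * u r ^ q * r ^ n - A r * (n * r ^ (n - 1))) / (r ^ n) ^ 2)) r :=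
    fun r hr => by
    have h := ((hAd r hr).div (hasDerivAt_pow n r) (pow_ne_zero n hr.ne')).neg
    refine h.congr_of_eventuallyEq ?_
    filter_upwards [Ioi_mem_nhds hr] with s hs
    simp only [hM, if_pos (mem_Ioi.1 hs)]
    rfl
  have hMv : ∀ r, 0 < r → M r = (ψ r / r) ^ (n - 1) * v r := fun r hr => by
    have hw := (hψ.pow_pos (n := n) hr).ne'
    simp only [hv, hM, if_pos hr]
    obtain ⟨k, rfl⟩ : ∃ k, n = k + 1 := ⟨n - 1, by omega⟩
    simp only [Nat.add_sub_cancel] at *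
    rw [div_pow, pow_succ]
    field_simp
  have hc : ContinuousOn v' (Ioi 0) := by
    have h1 : ContinuousOn A (Ioi 0) := fun r hr => (hAd r hr).continuousAt.continuousWithinAt
    have h2 : ContinuousOn (fun r => u r ^ q) (Ioi 0) :=
      hu.continuousOn.rpow_const fun _ _ => Or.inr hq.le
    have h3 : ContinuousOn (fun r => deriv ψ r / ψ r) (Ioi 0) :=
      hψ.continuousOn_deriv.div (hψ.continuousOn.mono Ioi_subset_Ici_self)
        fun r hr => (hψ.pos r hr).ne'
    have h4 : ContinuousOn (fun r : ℝ => r) (Ioi 0) := continuousOn_id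
    exact ((h2.div h4 fun r hr => ne_of_gt hr).sub ((h1.div (h4.mul hψ.continuousOn_pow)
      fun r hr => mul_ne_zero (ne_of_gt hr) (hψ.pow_pos hr).ne').mul
        ((continuousOn_const.div h4 fun r hr => ne_of_gt hr).add
          (continuousOn_const.mul h3)))).neg
  -- The limit is -(u(0)^q - (u(0)^q/n)(1 + (n-1))), and the terms cancel.
  have hz : Tendsto (fun r => r * v' r) (𝓝[>] 0) (𝓝 0) := by
    have h1 := hu.tendsto_radialFlux_div hψ hn hq hlim
    have h2 : Tendsto (fun r => 1 + ((n - 1 : ℕ) : ℝ) * (deriv ψ r / (ψ r / r))) (𝓝[>] 0)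
        (𝓝 (1 + ((n - 1 : ℕ) : ℝ) * (1 / 1))) :=
      ((hψ.tendsto_deriv_nhdsGT.div hψ.tendsto_div_nhdsGT one_ne_zero).const_mul _).const_add _
    have h3 := ((hlim.rpow_const (Or.inr hq.le) :
      Tendsto (fun r => u r ^ q) _ _).sub (h1.mul h2)).neg
    have h4 : -(u 0 ^ q - u 0 ^ q / n * (1 + ((n - 1 : ℕ) : ℝ) * (1 / 1))) = 0 := by
      rw [Nat.cast_sub (by omega)]
      push_cast
      field_simp
      ring
    rw [h4] at h3
    refine h3.congr' ?_
    filter_upwards [self_mem_nhdsWithin] with r hr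
    have : r ≠ 0 := ne_of_gt hr
    have := (hψ.pow_pos (n := n) hr).ne'
    have := (hψ.pos r hr).ne'
    simp only [hv', hA]
    field_simp
  have hslope := hu.tendsto_slope_zero hψ hn hq hlim
  have hn1 : 1 ≤ n := by omega
  refine ⟨contDiff_two_comp_norm hud hslope hvd hc hv0 hz, fun x => ?_, fun x => ?_⟩
  · rcases eq_or_ne x 0 with rfl | hx
    · simpa [radial] using hu0
    · exact hu.pos _ (norm_pos_iff.2 hx)
  · have hU : ∀ y : EuclideanSpace ℝ (Fin n),
        HasFDerivAt (radial n u) (innerSL ℝ (v ‖y‖ • y)) y :=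
      hasFDerivAt_comp_norm_of_slope hud hslope
    rcases eq_or_ne x 0 with rfl | hx
    · rw [laplaceBeltrami_radial_zero hn1 hψ.pos hU hMv hM0]
      simp only [hM, radial, norm_zero, lt_irrefl, if_false]
      field_simp
    · have hr : 0 < ‖x‖ := norm_pos_iff.2 hx
      have hw := (hψ.pow_pos (n := n) hr).ne'
      rw [laplaceBeltrami_radial_of_ne_zero hn1 hψ.pos hU hMv hx (hMd _ hr)]
      simp only [hM, if_pos hr, radial]
      obtain ⟨k, rfl⟩ : ∃ k, n = k + 1 := ⟨n - 1, by omega⟩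
      simp only [Nat.add_sub_cancel] at *
      rw [div_pow, pow_succ]
      field_simp
      ring

end LaneEmden

/-! ### The energy space inside weighted L² -/

section EnergySpace

open scoped RealInnerProductSpace

variable {n : ℕ} {ψ f φ : ℝ → ℝ} {a p : ℝ}

theorem IsModelFunction.weightedNorm_eq_eLpNorm (hψ : IsModelFunction ψ) (hp : 0 < p) (f : ℝ → ℝ) :
    weightedNorm n ψ p f = eLpNorm f (ENNReal.ofReal p) (radialMeasure n ψ) := by
  rw [eLpNorm_eq_lintegral_rpow_enorm_toReal (by simpa using hp) ENNReal.ofReal_ne_top,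
    ENNReal.toReal_ofReal hp.le, weightedNorm, radialMeasure,
    lintegral_withDensity_eq_lintegral_mul_non_measurable₀ _ hψ.aemeasurable_ofReal_pow
      (Eventually.of_forall fun _ => ENNReal.ofReal_lt_top)]
  congr 1
  refine lintegral_congr fun r => ?_
  rw [Pi.mul_apply, mul_comm (ENNReal.ofReal _), ENNReal.ofReal_mul (by positivity),
    ← ENNReal.ofReal_rpow_of_nonneg (abs_nonneg _) hp.le, Real.enorm_eq_ofReal_abs]

theorem IsModelFunction.weightedNorm_two_eq_eLpNorm (hψ : IsModelFunction ψ) (f : ℝ → ℝ) :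
    weightedNorm n ψ 2 f = eLpNorm f 2 (radialMeasure n ψ) := by
  rw [hψ.weightedNorm_eq_eLpNorm two_pos, ENNReal.ofReal_ofNat]

/-- A radial `C¹_c` function agrees on `(0, ∞)` with a `C¹_c` function on `ℝ`. -/
theorem IsC1cRadial.exists_contDiff (hn : 1 ≤ n) (hφ : IsC1cRadial n φ) :
    ∃ γ : ℝ → ℝ, ContDiff ℝ 1 γ ∧ HasCompactSupport γ ∧ EqOn γ φ (Ioi 0) := by
  -- Restriction to a line through the pole replaces φ on (-∞, 0), where its values are arbitrary,
  -- by an even extension.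
  set e : EuclideanSpace ℝ (Fin n) := EuclideanSpace.single ⟨0, hn⟩ 1 with he
  have hen : ‖e‖ = 1 := by simp [he]
  have he0 : e ≠ 0 := by
    rw [← norm_ne_zero_iff, hen]
    exact one_ne_zero
  refine ⟨fun t => radial n φ (t • e), hφ.1.comp (contDiff_id.smul contDiff_const),
    hφ.2.comp_isClosedEmbedding (isClosedEmbedding_smul_left he0), fun t ht => ?_⟩
  simp only [radial, norm_smul, hen, mul_one, Real.norm_eq_abs, abs_of_pos (mem_Ioi.1 ht)]

theorem deriv_eqOn_Ioi {f g : ℝ → ℝ} (h : EqOn f g (Ioi 0)) : EqOn (deriv f) (deriv g) (Ioi 0) :=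
  fun _ hr => (h.eventuallyEq_of_mem (Ioi_mem_nhds hr)).deriv_eq

theorem IsC1cRadial.integral_Ioi_deriv (hn : 1 ≤ n) (hφ : IsC1cRadial n φ) {r : ℝ} (hr : 0 < r) :
    ∫ s in Ioi r, deriv φ s = -φ r := by
  obtain ⟨γ, h1, h2, h3⟩ := hφ.exists_contDiff hn
  rw [← h3 hr, ← h2.integral_Ioi_deriv_eq h1 r]
  exact setIntegral_congr_fun measurableSet_Ioi fun s hs =>
    (deriv_eqOn_Ioi h3 (lt_trans hr hs)).symm

theorem IsModelFunction.memLp_deriv_of_isC1cRadial (hψ : IsModelFunction ψ) (hn : 1 ≤ n)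
    (hφ : IsC1cRadial n φ) : MemLp (deriv φ) 2 (radialMeasure n ψ) := by
  obtain ⟨γ, h1, h2, h3⟩ := hφ.exists_contDiff hn
  rw [memLp_two_iff_integrable_sq (measurable_deriv φ).aestronglyMeasurable,
    hψ.integrable_radialMeasure_iff]
  have hc : Continuous (deriv γ) := h1.continuous_deriv le_rfl
  obtain ⟨R, hR⟩ := h2.deriv.exists_pos_le_norm
  have hI1 : IntegrableOn (fun r => ψ r ^ (n - 1) * deriv γ r ^ 2) (Icc 0 R) :=
    (((hψ.continuousOn.mono Icc_subset_Ici_self).pow _).mul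
      (hc.pow 2).continuousOn).integrableOn_Icc
  have hI2 : IntegrableOn (fun r => ψ r ^ (n - 1) * deriv γ r ^ 2) (Ioi R) := by
    refine integrableOn_zero.congr_fun (fun r hr => ?_) measurableSet_Ioi
    have h4 : R ≤ ‖r‖ := (le_of_lt hr).trans (le_abs_self r)
    simp [hR.2 r h4]
  refine ((hI1.union hI2).mono_set fun r hr => ?_).congr_fun (fun r hr => ?_) measurableSet_Ioi
  · rcases le_or_gt r R with h | h
    · exact Or.inl ⟨le_of_lt hr, h⟩
    · exact Or.inr h
  · simp only [deriv_eqOn_Ioi h3 hr]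

theorem IsModelFunction.inner_tailVector_toLp (hψ : IsModelFunction ψ) (ht : HasTailBound n ψ a)
    (ha : 1 < a) {h : ℝ → ℝ} (hh : MemLp h 2 (radialMeasure n ψ)) {r : ℝ} (hr : 0 < r) :
    IntegrableOn h (Ioi r) ∧ ⟪tailVector n ψ r, hh.toLp h⟫ = ∫ s in Ioi r, h s := by
  have hac : volume.restrict (Ioi r) ≪ radialMeasure n ψ :=
    (Measure.restrict_mono (Ioi_subset_Ioi hr.le) le_rfl).absolutelyContinuous.trans
      hψ.absolutelyContinuous_radialMeasure
  have hae := hac.ae_le hh.coeFn_toLp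
  obtain ⟨h1, h2⟩ := hψ.inner_tailVector ht ha hr (hh.toLp h)
  exact ⟨(integrable_congr hae).1 h1, h2.trans (integral_congr_ae hae)⟩

theorem MemD12Rad.memLp_deriv (hψ : IsModelFunction ψ) (hn : 1 ≤ n) (hf : MemD12Rad n ψ f) :
    MemLp (deriv f) 2 (radialMeasure n ψ) := by
  obtain ⟨φ, hφ, -, hlim⟩ := hf
  obtain ⟨k, hk⟩ := (hlim.eventually_lt_const ENNReal.zero_lt_top).exists
  rw [hψ.weightedNorm_two_eq_eLpNorm] at hk
  have h1 : MemLp (fun r => deriv (φ k) r - deriv f r) 2 (radialMeasure n ψ) :=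
    ⟨((measurable_deriv _).sub (measurable_deriv _)).aestronglyMeasurable, hk⟩
  have h2 := (hψ.memLp_deriv_of_isC1cRadial hn (hφ k)).sub h1
  refine h2.ae_eq (Eventually.of_forall fun r => ?_)
  simp

/-- For C¹_c functions this is the fundamental theorem of calculus. In the limit the left side
converges by energy convergence and the right side pointwise, which fixes the constant. -/
theorem MemD12Rad.inner_tailVector_deriv (hψ : IsModelFunction ψ) (ht : HasTailBound n ψ a)
    (ha : 1 < a) (hn : 1 ≤ n) (hf : MemD12Rad n ψ f) {r : ℝ} (hr : 0 < r) :
    ⟪tailVector n ψ r, (hf.memLp_deriv hψ hn).toLp (deriv f)⟫ = -f r := by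
  have hf' := hf
  obtain ⟨φ, hφ, hpt, hlim⟩ := hf'
  have hφL := fun k => hψ.memLp_deriv_of_isC1cRadial hn (hφ k)
  have h1 : Tendsto (fun k => (hφL k).toLp (deriv (φ k))) atTop
      (𝓝 ((hf.memLp_deriv hψ hn).toLp (deriv f))) := by
    rw [Lp.tendsto_Lp_iff_tendsto_eLpNorm'']
    refine hlim.congr fun k => ?_
    rw [hψ.weightedNorm_two_eq_eLpNorm]
    rfl
  have h2 : Tendsto (fun k => ⟪tailVector n ψ r, (hφL k).toLp (deriv (φ k))⟫) atTop
      (𝓝 ⟪tailVector n ψ r, (hf.memLp_deriv hψ hn).toLp (deriv f)⟫) :=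
    tendsto_const_nhds.inner h1
  refine tendsto_nhds_unique h2 ((hpt r hr).neg.congr fun k => ?_)
  rw [(hψ.inner_tailVector_toLp ht ha (hφL k) hr).2, (hφ k).integral_Ioi_deriv hn hr]

theorem IsModelFunction.weightedNorm_two_deriv (hψ : IsModelFunction ψ) {h : ℝ → ℝ}
    (hh : MemLp h 2 (radialMeasure n ψ)) :
    weightedNorm n ψ 2 h = ENNReal.ofReal ‖hh.toLp h‖ := by
  rw [hψ.weightedNorm_two_eq_eLpNorm, Lp.norm_toLp, ENNReal.ofReal_toReal hh.2.ne]

theorem IsModelFunction.weightedNorm_eq_pairingFunctional (hψ : IsModelFunction ψ) (hp : 0 < p)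
    {h : Lp ℝ 2 (radialMeasure n ψ)}
    (hint : Integrable (fun r => |⟪tailVector n ψ r, h⟫| ^ p) (radialMeasure n ψ))
    (hf : ∀ r, 0 < r → ⟪tailVector n ψ r, h⟫ = -f r) :
    weightedNorm n ψ p f = ENNReal.ofReal
      (pairingFunctional (radialMeasure n ψ) (tailVector n ψ) p h ^ (1 / p)) := by
  rw [hψ.weightedNorm_eq_eLpNorm hp,
    eLpNorm_eq_lintegral_rpow_enorm_toReal (by simpa using hp) ENNReal.ofReal_ne_top,
    ENNReal.toReal_ofReal hp.le, ← ENNReal.ofReal_rpow_of_nonneg (pairingFunctional_nonneg _)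
      (one_div_nonneg.2 hp.le), pairingFunctional,
    ofReal_integral_eq_lintegral_ofReal hint (Eventually.of_forall fun _ => by positivity)]
  congr 1
  refine lintegral_congr_ae ?_
  filter_upwards [ae_radialMeasure_pos] with r hr
  rw [hf r hr, abs_neg, ← ENNReal.ofReal_rpow_of_nonneg (abs_nonneg _) hp.le,
    Real.enorm_eq_ofReal_abs]

/-- The Sobolev inequality on `D^{1,2}_rad`. -/
theorem inv_le_sobolevQuotient {q m : ℝ} (hψ : IsModelFunction ψ) (ht : HasTailBound n ψ a)
    (ha : 1 < a) (hn : 1 ≤ n) (hq : 0 < q + 1) (hm : 0 < m)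
    (hmax : ∀ h, pairingFunctional (radialMeasure n ψ) (tailVector n ψ) (q + 1) h ≤
      m * ‖h‖ ^ (q + 1))
    (hint : ∀ h, Integrable (fun r => |⟪tailVector n ψ r, h⟫| ^ (q + 1)) (radialMeasure n ψ))
    (hf : f ∈ D12RadNonzero n ψ) :
    (ENNReal.ofReal (m ^ (1 / (q + 1))))⁻¹ ≤ sobolevQuotient n ψ q f := by
  obtain ⟨hfD, r, hr, hfr⟩ := hf
  set h := (hfD.memLp_deriv hψ hn).toLp (deriv f) with hh
  have hin : ∀ r, 0 < r → ⟪tailVector n ψ r, h⟫ = -f r := fun r hr =>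
    hfD.inner_tailVector_deriv hψ ht ha hn hr
  have hh0 : 0 < ‖h‖ := by
    rw [norm_pos_iff]
    intro h0
    have := hin r hr
    rw [h0, inner_zero_right] at this
    exact hfr (neg_eq_zero.1 this.symm)
  have hM : 0 < m ^ (1 / (q + 1)) := Real.rpow_pos_of_pos hm _
  rw [sobolevQuotient, hψ.weightedNorm_two_deriv (hfD.memLp_deriv hψ hn),
    hψ.weightedNorm_eq_pairingFunctional hq (hint h) hin,
    ENNReal.le_div_iff_mul_le (Or.inr (ENNReal.ofReal_pos.2 hh0).ne') (Or.inr ENNReal.ofReal_ne_top),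
    ← ENNReal.ofReal_inv_of_pos hM, ← ENNReal.ofReal_mul (by positivity)]
  refine ENNReal.ofReal_le_ofReal ?_
  rw [inv_mul_le_iff₀ hM]
  calc pairingFunctional (radialMeasure n ψ) (tailVector n ψ) (q + 1) h ^ (1 / (q + 1))
      ≤ (m * ‖h‖ ^ (q + 1)) ^ (1 / (q + 1)) :=
        Real.rpow_le_rpow (pairingFunctional_nonneg _) (hmax h) (by positivity)
    _ = m ^ (1 / (q + 1)) * ‖h‖ := by
        rw [Real.mul_rpow hm.le (by positivity), ← Real.rpow_mul hh0.le,
          mul_one_div_cancel hq.ne', Real.rpow_one]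

end EnergySpace

/-! ### Approximation by truncating the derivative -/

section Approximation

open scoped RealInnerProductSpace

variable {n : ℕ} {ψ u d : ℝ → ℝ} {a p q : ℝ}

/-- A continuous function equal to `0` on `(-∞, k + 1]` and to `1` on `[k + 2, ∞)`. -/
noncomputable def tailCutoff (k : ℕ) (s : ℝ) : ℝ := max 0 (min 1 (s - (k + 1)))

theorem continuous_tailCutoff (k : ℕ) : Continuous (tailCutoff k) := by
  unfold tailCutoff; fun_prop

theorem tailCutoff_nonneg (k : ℕ) (s : ℝ) : 0 ≤ tailCutoff k s := le_max_left _ _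

theorem tailCutoff_le_one (k : ℕ) (s : ℝ) : tailCutoff k s ≤ 1 :=
  max_le zero_le_one (min_le_left _ _)

theorem tailCutoff_of_le {k : ℕ} {s : ℝ} (h : s ≤ k + 1) : tailCutoff k s = 0 :=
  max_eq_left ((min_le_right _ _).trans (by linarith))

theorem tailCutoff_of_ge {k : ℕ} {s : ℝ} (h : k + 2 ≤ s) : tailCutoff k s = 1 := by
  rw [tailCutoff, min_eq_left (by linarith), max_eq_right zero_le_one]

theorem eventually_tailCutoff_eq_zero (s : ℝ) : ∀ᶠ k : ℕ in atTop, tailCutoff k s = 0 := by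
  obtain ⟨N, hN⟩ := exists_nat_ge s
  filter_upwards [eventually_ge_atTop N] with k hk
  refine tailCutoff_of_le ?_
  have : (N : ℝ) ≤ k := by exact_mod_cast hk
  linarith

theorem norm_tailCutoff_mul_le (k : ℕ) (s x : ℝ) : ‖tailCutoff k s * x‖ ≤ ‖x‖ := by
  rw [norm_mul, Real.norm_of_nonneg (tailCutoff_nonneg k s)]
  exact mul_le_of_le_one_left (norm_nonneg _) (tailCutoff_le_one k s)

theorem integrableOn_tailCutoff_mul (hd : ∀ r, 0 < r → IntegrableOn d (Ioi r)) (k : ℕ) (r : ℝ) :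
    IntegrableOn (fun s => tailCutoff k s * d s) (Ioi r) := by
  have h1 : IntegrableOn (fun s => tailCutoff k s * d s) (Ioi 1) :=
    Integrable.mono (hd 1 one_pos) ((continuous_tailCutoff k).aestronglyMeasurable.mul (hd 1 one_pos).1)
      (Eventually.of_forall fun s => norm_tailCutoff_mul_le k s _)
  have h2 : IntegrableOn (fun s => tailCutoff k s * d s) (Iic 1) := by
    refine integrableOn_zero.congr_fun (fun s hs => ?_) measurableSet_Iic
    rw [tailCutoff_of_le ((mem_Iic.1 hs).trans (by simp)), zero_mul]
  have h3 := h2.union h1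
  rw [Iic_union_Ioi] at h3
  exact h3.mono_set (subset_univ _)

theorem integral_Ioi_tailCutoff_mul_of_le (k : ℕ) {r : ℝ} (hr : r ≤ k + 1) :
    ∫ s in Ioi r, tailCutoff k s * d s = ∫ s in Ioi ((k : ℝ) + 1), tailCutoff k s * d s := by
  refine (setIntegral_eq_of_subset_of_forall_sdiff_eq_zero measurableSet_Ioi
    (Ioi_subset_Ioi hr) fun s hs => ?_)
  rw [tailCutoff_of_le (not_lt.1 hs.2), zero_mul]

/-- The function is constant on the ball of radius k + 1, so the pole causes no difficulty. -/
theorem contDiff_radial_integral_tailCutoff_mul (hdc : ContinuousOn d (Ioi 0))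
    (hd : ∀ r, 0 < r → IntegrableOn d (Ioi r)) (k : ℕ) :
    ContDiff ℝ 1 (radial n fun r => ∫ s in Ioi r, tailCutoff k s * d s) := by
  rw [contDiff_iff_contDiffAt]
  intro x
  have hc : ContinuousOn (fun s => tailCutoff k s * d s) (Ioi 0) :=
    (continuous_tailCutoff k).continuousOn.mul hdc
  have hder : ∀ r, 0 < r → HasDerivAt (fun r => ∫ s in Ioi r, tailCutoff k s * d s)
      (-(tailCutoff k r * d r)) r := fun r hr =>
    hasDerivAt_integral_Ioi hc (fun r _ => integrableOn_tailCutoff_mul hd k r) hr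
  rcases eq_or_ne x 0 with rfl | hx
  · refine (contDiffAt_const
      (c := ∫ s in Ioi ((k : ℝ) + 1), tailCutoff k s * d s)).congr_of_eventuallyEq ?_
    have : (0 : ℝ) < k + 1 := by positivity
    filter_upwards [Metric.ball_mem_nhds 0 this] with y hy
    exact integral_Ioi_tailCutoff_mul_of_le k (mem_ball_zero_iff.1 hy).le
  · have hx' : 0 < ‖x‖ := norm_pos_iff.2 hx
    have h1 : ContDiffOn ℝ (0 + 1) (fun r => ∫ s in Ioi r, tailCutoff k s * d s) (Ioi 0) := by
      rw [contDiffOn_succ_iff_deriv_of_isOpen isOpen_Ioi]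
      refine ⟨fun r hr => (hder r hr).differentiableAt.differentiableWithinAt, by simp, ?_⟩
      rw [contDiffOn_zero]
      exact hc.neg.congr fun r hr => (hder r hr).deriv
    rw [zero_add] at h1
    exact (h1.contDiffAt (Ioi_mem_nhds hx')).comp x (contDiffAt_norm ℝ hx)

/-- The approximants subtract from `u` the tail integral of χ_k d, with χ_k the cutoff; this equals
`u` beyond k + 2. Cutting off the derivative rather than `u` leaves the error χ_k d, which tends to
0 in L² by dominated convergence with no term containing χ_k'. -/
theorem memD12Rad_of_eq_integral (hψ : IsModelFunction ψ) (hu : ContDiff ℝ 1 (radial n u))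
    (hdc : ContinuousOn d (Ioi 0)) (hd : ∀ r, 0 < r → IntegrableOn d (Ioi r))
    (hud : ∀ r, 0 < r → u r = ∫ s in Ioi r, d s)
    (hdL : MemLp d 2 (radialMeasure n ψ)) : MemD12Rad n ψ u := by
  have hc : ∀ k, ContinuousOn (fun s => tailCutoff k s * d s) (Ioi 0) := fun k =>
    (continuous_tailCutoff k).continuousOn.mul hdc
  have hu' : ∀ r, 0 < r → HasDerivAt u (-d r) r := fun r hr =>
    (hasDerivAt_integral_Ioi hdc hd hr).congr_of_eventuallyEq
      (by filter_upwards [Ioi_mem_nhds hr] with s hs using hud s hs)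
  refine ⟨fun k r => u r - ∫ s in Ioi r, tailCutoff k s * d s, fun k => ⟨?_, ?_⟩, fun r hr => ?_,
    ?_⟩
  · exact hu.sub (contDiff_radial_integral_tailCutoff_mul hdc hd k)
  · refine HasCompactSupport.intro (isCompact_closedBall 0 ((k : ℝ) + 2)) fun x hx => ?_
    rw [mem_closedBall_zero_iff, not_le] at hx
    have hx0 : 0 < ‖x‖ := lt_trans (by positivity) hx
    change u ‖x‖ - _ = 0
    rw [hud _ hx0, sub_eq_zero]
    refine setIntegral_congr_fun measurableSet_Ioi fun s hs => ?_
    rw [tailCutoff_of_ge (hx.le.trans (le_of_lt hs)), one_mul]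
  · have h1 : Tendsto (fun k : ℕ => ∫ s in Ioi r, tailCutoff k s * d s) atTop
        (𝓝 (∫ s in Ioi r, (0 : ℝ))) := by
      refine tendsto_integral_of_dominated_convergence (fun s => ‖d s‖)
        (fun k => (integrableOn_tailCutoff_mul hd k r).1) (hd r hr).norm
        (fun k => Eventually.of_forall fun s => norm_tailCutoff_mul_le k s _)
        (Eventually.of_forall fun s => ?_)
      refine tendsto_const_nhds.congr' ?_
      filter_upwards [eventually_tailCutoff_eq_zero s] with k hk
      rw [hk, zero_mul]
    simpa using h1.const_sub (u r)
  · have heq : ∀ k, weightedNorm n ψ 2 (fun r => deriv (fun r => u r -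
        ∫ s in Ioi r, tailCutoff k s * d s) r - deriv u r) =
        (∫⁻ r, ‖tailCutoff k r * d r‖ₑ ^ (2 : ℝ) ∂(radialMeasure n ψ)) ^ (1 / 2 : ℝ) := fun k => by
      rw [hψ.weightedNorm_two_eq_eLpNorm,
        eLpNorm_eq_lintegral_rpow_enorm_toReal two_ne_zero ENNReal.ofNat_ne_top,
        ENNReal.toReal_ofNat]
      congr 1
      refine lintegral_congr_ae ?_
      filter_upwards [ae_radialMeasure_pos] with r hr
      have hder : HasDerivAt (fun r => u r - ∫ s in Ioi r, tailCutoff k s * d s)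
          (-d r - -(tailCutoff k r * d r)) r :=
        (hu' r hr).sub (hasDerivAt_integral_Ioi (hc k)
          (fun r _ => integrableOn_tailCutoff_mul hd k r) hr)
      rw [hder.deriv, (hu' r hr).deriv]
      congr 2
      ring
    simp only [heq]
    have hfin : ∫⁻ r, ‖d r‖ₑ ^ (2 : ℝ) ∂(radialMeasure n ψ) ≠ ⊤ := by
      have := lintegral_rpow_enorm_lt_top_of_eLpNorm_lt_top two_ne_zero ENNReal.ofNat_ne_top hdL.2
      simpa using this.ne
    have h0 : Tendsto (fun k : ℕ => ∫⁻ r, ‖tailCutoff k r * d r‖ₑ ^ (2 : ℝ) ∂(radialMeasure n ψ))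
        atTop (𝓝 (∫⁻ _, 0 ∂(radialMeasure n ψ))) := by
      refine tendsto_lintegral_of_dominated_convergence' (fun r => ‖d r‖ₑ ^ (2 : ℝ)) (fun k => ?_)
        (fun k => Eventually.of_forall fun r => ?_) hfin (Eventually.of_forall fun r => ?_)
      · exact (((continuous_tailCutoff k).aestronglyMeasurable.mul hdL.1).enorm).pow_const _
      · have := norm_tailCutoff_mul_le k r (d r)
        simp only
        gcongr
        exact enorm_le_iff_norm_le.2 this
      · refine tendsto_const_nhds.congr' ?_
        filter_upwards [eventually_tailCutoff_eq_zero r] with k hk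
        simp [hk]
    have h1 := h0.ennrpow_const (1 / 2 : ℝ)
    simpa using h1

end Approximation

/-! ### Existence of the minimizer -/

section Existence

open scoped RealInnerProductSpace

variable {n : ℕ} {ψ : ℝ → ℝ} {a q : ℝ}

theorem exists_isSobolevMinimizer (hn : 2 ≤ n) (hψ : IsModelFunction ψ)
    (ht : HasTailBound n ψ a) (ha : 1 < a) (hq : 1 < q) (hqa : 2 * (a + 1) / (a - 1) < q + 1)
    {β : ℝ} (hβ : ((n : ℝ) - 2) / 2 < β) (hβq : 1 / q < β) (hβn : β * (q + 1) < n)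
    (hβ2 : β * (q - 1) < 2) :
    ∃ u : ℝ → ℝ, IsLaneEmdenSolution n ψ q (radial n u) ∧ MemD12Rad n ψ u ∧
      IsSobolevMinimizer n ψ q u := by
  have hn1 : 1 ≤ n := by omega
  have hq0 : 0 < q := by linarith
  have hq1 : 0 < q + 1 := by linarith
  obtain ⟨g, m, hg1, hm, hg0, hmJ, hmax, hint, hgreen⟩ := hψ.exists_extremal ht ha
    (by linarith : 2 < q + 1)
    (integrableOn_radialGreen_rpow_mul hn hψ ht ha (by linarith) hqa hβ hβn)
  rw [add_sub_cancel_right] at hgreen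
  set f : ℝ → ℝ := fun r => ∫ s in Ioi r, g s with hf
  have hgi : ∀ r, 0 < r → IntegrableOn g (Ioi r) := fun r hr =>
    (hψ.inner_tailVector ht ha hr g).1
  have hfin : ∀ r, 0 < r → ⟪tailVector n ψ r, g⟫ = f r := fun r hr =>
    (hψ.inner_tailVector ht ha hr g).2
  have hac : ∀ r : ℝ, 0 < r → volume.restrict (Ioi r) ≪ radialMeasure n ψ := fun r hr =>
    (Measure.restrict_mono (Ioi_subset_Ioi hr.le) le_rfl).absolutelyContinuous.trans
      hψ.absolutelyContinuous_radialMeasure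
  have hg0' : ∀ r : ℝ, 0 < r → 0 ≤ᵐ[volume.restrict (Ioi r)] g := fun r hr =>
    (hac r hr).ae_le hg0
  have hf0 : ∀ r, 0 < r → 0 ≤ f r := fun r hr => integral_nonneg_of_ae (hg0' r hr)
  have hanti : AntitoneOn f (Ioi 0) := fun r hr s _ hrs =>
    setIntegral_mono_set (hgi r hr) (hg0' r hr) (Ioi_subset_Ioi hrs).eventuallyLE
  have hfc : ContinuousOn f (Ioi 0) := continuousOn_integral_Ioi hgi
  have hne : ∃ r, 0 < r ∧ f r ≠ 0 := by
    by_contra! hcon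
    refine hm.ne' (hmJ.trans (integral_eq_zero_of_ae ?_))
    filter_upwards [ae_radialMeasure_pos] with r hr
    rw [hfin r hr, hcon r hr, abs_zero, Real.zero_rpow hq1.ne']
    rfl
  have hgreen1 := fun r hr => (hgreen r hr).1
  have hgreen2 := fun r hr => (hgreen r hr).2
  have hfpos : ∀ r, 0 < r → 0 < f r := fun r hr =>
    hψ.pos_of_green ht ha hm hf0 hanti hne hgreen1 hgreen2 hr
  -- Since -Δ f = f^q / m, the multiple c f solves the equation when c^(q-1) = 1/m.
  set c : ℝ := m ^ (-(1 / (q - 1))) with hc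
  have hc0 : 0 < c := Real.rpow_pos_of_pos hm _
  have hcq : c ^ q = c / m := by
    have h1 : c ^ (q - 1) = m⁻¹ := by
      rw [hc, ← Real.rpow_mul hm.le, neg_mul, one_div_mul_cancel (by linarith), Real.rpow_neg_one]
    have h2 : c ^ q = c ^ (q - 1) * c := by
      rw [← Real.rpow_add_one hc0.ne', sub_add_cancel]
    rw [h2, h1]
    field_simp
  -- For a nonincreasing function the supremum is the limit at 0; that it is finite is known only
  -- after the bootstrap.
  set u : ℝ → ℝ := fun r => if 0 < r then c * f r else
    sSup ((fun r => c * f r) '' Ioi 0) with hu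
  have hur : ∀ r, 0 < r → u r = c * f r := fun r hr => if_pos hr
  have huq : ∀ r : ℝ, EqOn (fun s => ψ s ^ (n - 1) * u s ^ q)
      (fun s => c ^ q * (ψ s ^ (n - 1) * f s ^ q)) (Ioc 0 r) := fun r s hs => by
    simp only
    rw [hur s hs.1, Real.mul_rpow hc0.le (hf0 s hs.1)]
    ring
  have hsol : IsRadialSolution n ψ q u := by
    refine ⟨fun r hr => ?_, fun r hr => ?_, fun r hr => ?_⟩
    · rw [hur r hr]
      exact mul_pos hc0 (hfpos r hr)
    · have h := (hψ.intervalIntegrable_of_green ht ha hgreen1 hr).const_mul (c ^ q)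
      refine h.congr (fun s hs => ?_)
      rw [uIoc_of_le hr.le] at hs
      exact (huq r hs).symm
    · have h := (hψ.hasDerivAt_of_green ht ha hq0 hm hfc hgreen1 hgreen2 hr).const_mul c
      refine (h.congr_of_eventuallyEq ?_).congr_deriv ?_
      · filter_upwards [Ioi_mem_nhds hr] with s hs using hur s hs
      · rw [intervalIntegral.integral_of_le hr.le, intervalIntegral.integral_of_le hr.le,
          setIntegral_congr_fun measurableSet_Ioc (huq r), integral_const_mul, hcq]
        have := (hψ.pow_pos (n := n) hr).ne'
        field_simp
  obtain ⟨r₀, hr₀, hr₀1, hb⟩ := hψ.exists_half_le_le_two_mul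
  obtain ⟨C, hC, hCb⟩ := exists_radialGreen_le_rpow hψ ht ha hn hβ hr₀ hr₀1 fun r h h' =>
    (hb r h h').1
  have hudecay : ∀ r, 0 < r → r ≤ r₀ → u r ≤ c * C ^ (1 / 2 : ℝ) * r ^ (-β) := fun r hr hrr => by
    have h1 : f r ≤ radialGreen n ψ r ^ (1 / 2 : ℝ) := by
      have h2 := real_inner_le_norm (tailVector n ψ r) g
      rwa [hg1, mul_one, hψ.norm_tailVector ht ha hr, hfin r hr] at h2
    have h3 : radialGreen n ψ r ^ (1 / 2 : ℝ) ≤ (C * r ^ (-(2 * β))) ^ (1 / 2 : ℝ) :=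
      Real.rpow_le_rpow (radialGreen_nonneg hψ hr.le) (hCb r hr hrr) (by norm_num)
    rw [Real.mul_rpow hC.le (by positivity), ← Real.rpow_mul hr.le,
      show -(2 * β) * (1 / 2) = -β by ring] at h3
    rw [hur r hr, mul_assoc]
    gcongr
    exact h1.trans h3
  obtain ⟨B, hB⟩ := hsol.bounded_near_zero hn hq hψ hr₀ hr₀1 hb hβq hβn hβ2 hudecay
  have hcanti : AntitoneOn (fun r => c * f r) (Ioi 0) := fun r hr s hs hrs =>
    mul_le_mul_of_nonneg_left (hanti hr hs hrs) hc0.le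
  have hbdd : BddAbove ((fun r => c * f r) '' Ioi 0) := by
    refine ⟨B, ?_⟩
    rintro _ ⟨r, hr, rfl⟩
    rcases le_total r r₀ with h | h
    · exact (hur r hr).ge.trans (hB r hr h)
    · exact (hcanti hr₀ hr h).trans ((hur r₀ hr₀).ge.trans (hB r₀ hr₀ le_rfl))
  have hu0 : u 0 = sSup ((fun r => c * f r) '' Ioi 0) := if_neg (lt_irrefl 0)
  have hlim : Tendsto u (𝓝[>] 0) (𝓝 (u 0)) := by
    rw [hu0]
    refine (hcanti.tendsto_nhdsGT hbdd).congr' ?_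
    filter_upwards [self_mem_nhdsWithin] with r hr using (hur r hr).symm
  have hu0pos : 0 < u 0 := by
    rw [hu0]
    exact (mul_pos hc0 (hfpos 1 one_pos)).trans_le (le_csSup hbdd ⟨1, mem_Ioi.2 one_pos, rfl⟩)
  have hLE := hsol.isLaneEmdenSolution hψ hn hq0 hlim hu0pos
  set d : ℝ → ℝ := fun r => radialFlux n ψ q u r / ψ r ^ (n - 1) with hd
  have hud : ∀ r, 0 < r → HasDerivAt u (-d r) r := hsol.hasDerivAt
  have hdc : ContinuousOn d (Ioi 0) :=
    ContinuousOn.div (fun r hr => (hsol.hasDerivAt_radialFlux hψ hq0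
      hr).continuousAt.continuousWithinAt) hψ.continuousOn_pow fun r hr => (hψ.pow_pos hr).ne'
  -- The class `g` agrees a.e. with a continuous function: both sides are -u', by the equation and
  -- by Lebesgue differentiation.
  have hdg : ∀ᵐ r ∂(volume.restrict (Ioi 0)), d r = c * g r := by
    filter_upwards [ae_hasDerivAt_integral_Ioi hgi, ae_restrict_mem measurableSet_Ioi]
      with r hr hr0
    have h1 : HasDerivAt u (c * -g r) r := (hr.const_mul c).congr_of_eventuallyEq
      (by filter_upwards [Ioi_mem_nhds hr0] with s hs using hur s hs)
    have h2 := (hud r hr0).unique h1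
    linarith
  have hdg' : d =ᵐ[radialMeasure n ψ] fun r => c * g r :=
    radialMeasure_absolutelyContinuous.ae_le hdg
  have hdL : MemLp d 2 (radialMeasure n ψ) := (memLp_congr_ae hdg').2 ((Lp.memLp g).const_mul c)
  have hdi : ∀ r, 0 < r → IntegrableOn d (Ioi r) := fun r hr =>
    (hψ.inner_tailVector_toLp ht ha hdL hr).1
  have hueq : ∀ r, 0 < r → u r = ∫ s in Ioi r, d s := fun r hr => by
    rw [hur r hr, hf, ← integral_const_mul]
    exact (integral_congr_ae ((hac r hr).ae_le hdg')).symm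
  have hmem : MemD12Rad n ψ u :=
    memD12Rad_of_eq_integral hψ (hLE.contDiff.of_le (by norm_num)) hdc hdi hueq hdL
  have huD : u ∈ D12RadNonzero n ψ := ⟨hmem, 1, one_pos, (hsol.pos 1 one_pos).ne'⟩
  have hLu := hmem.memLp_deriv hψ hn1
  have htoLp : hLu.toLp (deriv u) = (-c) • g := by
    refine Lp.ext ?_
    filter_upwards [hLu.coeFn_toLp, Lp.coeFn_smul (-c) g, hdg', ae_radialMeasure_pos]
      with r h1 h2 h3 h4
    rw [h1, h2, (hud r h4).deriv, h3]
    simp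
  have henergy : weightedNorm n ψ 2 (deriv u) = ENNReal.ofReal c := by
    rw [hψ.weightedNorm_two_deriv hLu, htoLp, norm_smul, hg1, mul_one, norm_neg,
      Real.norm_of_nonneg hc0.le]
  have hin : ∀ r, 0 < r → ⟪tailVector n ψ r, (-c) • g⟫ = -u r := fun r hr => by
    rw [inner_smul_right, hfin r hr, hur r hr, neg_mul]
  have hnorm : weightedNorm n ψ (q + 1) u =
      ENNReal.ofReal c * ENNReal.ofReal (m ^ (1 / (q + 1))) := by
    rw [hψ.weightedNorm_eq_pairingFunctional hq1 (hint _) hin, pairingFunctional_smul, ← hmJ,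
      abs_neg, abs_of_pos hc0, Real.mul_rpow (by positivity) hm.le, ← Real.rpow_mul hc0.le,
      mul_one_div_cancel hq1.ne', Real.rpow_one, ENNReal.ofReal_mul hc0.le]
  -- The quotient is scale invariant, so `c` drops out and the maximal value `m` remains.
  have hquot : sobolevQuotient n ψ q u = (ENNReal.ofReal (m ^ (1 / (q + 1))))⁻¹ := by
    have hc' : ENNReal.ofReal c ≠ 0 := (ENNReal.ofReal_pos.2 hc0).ne'
    rw [sobolevQuotient, henergy, hnorm, div_eq_mul_inv,
      ENNReal.mul_inv (Or.inl hc') (Or.inl ENNReal.ofReal_ne_top), ← mul_assoc,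
      ENNReal.mul_inv_cancel hc' ENNReal.ofReal_ne_top, one_mul]
  refine ⟨u, hLE, hmem, huD, ?_, le_antisymm ?_ (iInf₂_le u huD)⟩
  · rw [hnorm]
    exact ENNReal.mul_lt_top ENNReal.ofReal_lt_top ENNReal.ofReal_lt_top
  · rw [hquot]
    exact le_iInf₂ fun f hf => inv_le_sobolevQuotient hψ ht ha hn1 hq1 hm hmax hint hf

end Existence

theorem mainTheorem3 (n : ℕ) (hn : 2 ≤ n) (α : ℝ) (hα : 1 < α)
    (ψ σ : ℝ → ℝ) (hψ : IsModelFunction ψ) (hσ : IsModelFunction σ)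
    (hσ_growth : ∃ κ₁ κ₂ : ℝ, 0 < κ₁ ∧ 0 < κ₂ ∧
      ∀ᶠ r in atTop, κ₁ * r ^ α ≤ σ r ∧ σ r ≤ κ₂ * r ^ α)
    (hψσ : ∀ r : ℝ, 0 < r → deriv σ r / σ r ≤ deriv ψ r / ψ r)
    (q : ℝ) (hq_lower : sobolevExponentAlpha n α - 1 < q)
    (hq_upper : (q : EReal) < sobolevExponent n - 1) :
    ∃ u : ℝ → ℝ, IsLaneEmdenSolution n ψ q (radial n u) ∧ MemD12Rad n ψ u ∧
      IsSobolevMinimizer n ψ q u := by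
  have hn' : (2 : ℝ) ≤ n := by exact_mod_cast hn
  have ha : 1 < α * ((n : ℝ) - 1) := by nlinarith
  have hqa : 2 * (α * ((n : ℝ) - 1) + 1) / (α * ((n : ℝ) - 1) - 1) < q + 1 := by
    rw [sobolevExponentAlpha] at hq_lower
    linarith
  -- With a = α(n-1) > 1, the exponent 2(a+1)/(a-1) always exceeds 2.
  have hq : 1 < q := by
    have h1 : 2 < 2 * (α * ((n : ℝ) - 1) + 1) / (α * ((n : ℝ) - 1) - 1) := by
      rw [lt_div_iff₀ (by linarith)]
      linarith
    linarith
  obtain ⟨β, h1, h2, h3, h4⟩ := exists_decay_exponent hn hq hq_upper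
  exact exists_isSobolevMinimizer hn hψ (hasTailBound_of_deriv_div_le hn hψ hσ hσ_growth hψσ) ha
    hq hqa h1 h2 h3 h4
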